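/- Let $d\in\mathbb N$ and write points of $(\mathbb R^{2d})^k$ as $\underline z_k=(z_1,\dots,z_k)$, $z_i=(x_i,v_i)$. For $k\ge 1$ let $\mathfrak g_k$ be the space of real $C^\infty$ functions on $(\mathbb R^{2d})^k$ that are invariant under permutations of $z_1,\dots,z_k$, with the topology of uniform convergence of all derivatives on compact sets, and let $\mathfrak g_k^*$ be its strong dual. Elements $\gamma$ of $\mathfrak g_k^*$ are regarded as symmetric compactly supported distributions through $\gamma(h):=\gamma(\mathrm{Sym}_k h)$, $\mathrm{Sym}_k h=\frac1{k!}\sum_{\pi\in\mathbb S_k}h\circ\pi$. Let $\mathfrak G_\infty=\bigoplus_{k\ge1}\mathfrak g_k$ and $\mathfrak G_\infty^*=\prod_{k\ge1}\mathfrak g_k^*$ (product topology), with pairing $\langle F,\Gamma\rangle=\sum_k\gamma^{(k)}(f^{(k)})$ for $F=(f^{(k)})_k$, $\Gamma=(\gamma^{(k)})_k$. For $F,G\in\mathfrak G_\infty$ put $$[F,G]_{\mathfrak G_\infty}^{(k)}=\sum_{\ell+j-1=k}\mathrm{Sym}_k\big(f^{(\ell)}\wedge_1 g^{(j)}\big),$$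 $$f^{(\ell)}\wedge_1 g^{(j)}(\underline z_k)=\ell j\Big(\nabla_{x_1}f^{(\ell)}(z_1,\dots,z_\ell)\cdot\nabla_{v_1}g^{(j)}(z_1,z_{\ell+1},\dots,z_k)-\nabla_{x_1}g^{(j)}(z_1,\dots,z_j)\cdot\nabla_{v_1}f^{(\ell)}(z_1,z_{j+1},\dots,z_k)\Big).$$ Smoothness is in the Gâteaux sense: $\mathsf d f[x](v)=\lim_{h\to0}\frac1h(f(x+hv)-f(x))$, and $f\in C^\infty(X,Y)$ if all iterated derivatives $\mathsf d^nf:X\times X^n\to Y$, $n\ge0$, exist and are continuous; $C^\infty(X)=C^\infty(X,\mathbb R)$. Let $\mathcal A_\infty\subset C^\infty(\mathfrak G_\infty^*)$ be the algebra (pointwise product) generated by the expectation functionals $\Gamma\mapsto\langle F,\Gamma\rangle$, $F\in\mathfrak G_\infty$, and the constants. (1) For all $\mathcal F\in C^\infty(\mathfrak G_\infty^*)$ and $\Gamma\in\mathfrak G_\infty^*$ there is exactly one element of $\mathfrak G_\infty$, again denoted $\mathsf d\mathcal F[\Gamma]$, such that $\mathsf d\mathcal F[\Gamma](\Delta)=\langle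 \mathsf d\mathcal F[\Gamma],\Delta\rangle$ for all $\Delta\in\mathfrak G_\infty^*$. Hence $$\{\mathcal F,\mathcal G\}(\Gamma):=\big\langle[\mathsf d\mathcal F[\Gamma],\mathsf d\mathcal G[\Gamma]]_{\mathfrak G_\infty},\Gamma\big\rangle$$ is defined for all $\mathcal F,\mathcal G\in C^\infty(\mathfrak G_\infty^*)$ and $\Gamma\in\mathfrak G_\infty^*$. (2) $(\mathfrak G_\infty^*,\mathcal A_\infty,\{\cdot,\cdot\})$ is a weak Poisson vector space. That is: $\mathcal A_\infty$ is a unital subalgebra of $C^\infty(\mathfrak G_\infty^*)$; $\{\cdot,\cdot\}$ maps $\mathcal A_\infty\times\mathcal A_\infty$ into $\mathcal A_\infty$, is bilinear and antisymmetric, satisfies the Jacobi identity and the Leibniz rule $\{\mathcal F,\mathcal G\mathcal H\}=\mathcal H\{\mathcal F,\mathcal G\}+\mathcal G\{\mathcal F,\mathcal H\}$; if $\Gamma,v\in\mathfrak G_\infty^*$ and $\mathsf d\mathcal F[\Gamma](v)=0$ for all $\mathcal F\in\mathcal A_\infty$, then $v=0$; and for every $\mathcal F\in\mathcal A_\infty$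 there is $X_{\mathcal F}\in C^\infty(\mathfrak G_\infty^*,\mathfrak G_\infty^*)$ with $\mathsf d\mathcal G[\Gamma](X_{\mathcal F}(\Gamma))=\{\mathcal G,\mathcal F\}(\Gamma)$ for all $\mathcal G\in\mathcal A_\infty$ and $\Gamma\in\mathfrak G_\infty^*$. (3) For every $\mathcal G\in C^\infty(\mathfrak G_\infty^*)$ there is a unique map $X_{\mathcal G}:\mathfrak G_\infty^*\to\mathfrak G_\infty^*$ such that $\{\mathcal F,\mathcal G\}(\Gamma)=\mathsf d\mathcal F[\Gamma](X_{\mathcal G}(\Gamma))$ for all $\mathcal F\in C^\infty(\mathfrak G_\infty^*)$ and $\Gamma\in\mathfrak G_\infty^*$. It is given by $$X_{\mathcal G}(\Gamma)^{(\ell)}=\sum_{j=1}^\infty j\int_{(\mathbb R^{2d})^{j-1}}dz_{\ell+1}\cdots dz_{\ell+j-1}\Big\{\sum_{\alpha=1}^{\ell}\mathsf d\mathcal G[\Gamma]^{(j)}_{(\alpha,\ell+1,\dots,\ell+j-1)},\gamma^{(\ell+j-1)}\Big\}_{(\mathbb R^{2d})^{\ell+j-1}},\qquad \ell\ge1,$$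 a sum with finitely many nonzero terms. Here $g_{(i_1,\dots,i_j)}(\underline z_k)=g(z_{i_1},\dots,z_{i_j})$; for a smooth function $h$ and a distribution $T$ on $(\mathbb R^{2d})^k$, $\{h,T\}_{(\mathbb R^{2d})^k}=\sum_{\beta=1}^k(\nabla_{x_\beta}h\cdot\nabla_{v_\beta}T-\nabla_{v_\beta}h\cdot\nabla_{x_\beta}T)$ in the sense of distributions; and the integral is the marginal, i.e. $\int dz_{\ell+1}\cdots dz_k\,T$ is the functional $\varphi\mapsto T(\varphi\otimes 1^{\otimes(k-\ell)})$ on $\mathfrak g_\ell$. If $\mathcal G\in\mathcal A_\infty$, then $X_{\mathcal G}\in C^\infty(\mathfrak G_\infty^*,\mathfrak G_\infty^*)$. -/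

import Mathlib

open Filter Topology TopologicalSpace
open scoped ContDiff DirectSum

noncomputable section

namespace VlasovHierarchy

/-! Gateaux calculus in topological vector spaces -/

section Gateaux

variable {X Y : Type*} [AddCommGroup X] [Module ℝ X] [TopologicalSpace X]
  [AddCommGroup Y] [Module ℝ Y] [TopologicalSpace Y]

/-- The directional limit `lim_{h → 0} (f (x + h v) - f x) / h` exists and equals `y`. -/
def HasGateauxDeriv (f : X → Y) (x v : X) (y : Y) : Prop :=
  Tendsto (fun h : ℝ => h⁻¹ • (f (x + h • v) - f x)) (𝓝[≠] 0) (𝓝 y)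

/-- The Gateaux derivative `df[x](v) = lim_{h → 0} (f (x + h v) - f x) / h`. -/
def gateauxDeriv (f : X → Y) (x v : X) : Y :=
  haveI : Nonempty Y := ⟨0⟩
  limUnder (𝓝[≠] (0 : ℝ)) (fun h : ℝ => h⁻¹ • (f (x + h • v) - f x))

/-- `f` is `C^∞`: all iterated Gateaux derivatives
`D n x (v₁, …, vₙ) = dⁿf[x](v₁, …, vₙ)` exist and are jointly continuous on `X × Xⁿ`. -/
def IsGateauxSmooth (f : X → Y) : Prop :=
  ∃ D : (n : ℕ) → X → (Fin n → X) → Y,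
    (∀ x v, D 0 x v = f x) ∧
    (∀ n x (v : Fin n → X) (w : X),
      HasGateauxDeriv (fun y => D n y v) x w (D (n + 1) x (Fin.snoc v w))) ∧
    ∀ n, Continuous (fun p : X × (Fin n → X) => D n p.1 p.2)

end Gateaux

/-- Weak Poisson vector space: a locally convex space `X`, a unital algebra `A` of `C^∞`
functionals on `X` (with the pointwise product), and a bracket on `A` (only the values of `pb` on
`A × A` are used). -/
structure IsWeakPoissonVectorSpace {X : Type*} [AddCommGroup X] [Module ℝ X] [TopologicalSpace X]
    [IsTopologicalAddGroup X] [ContinuousSMul ℝ X] [LocallyConvexSpace ℝ X]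
    (A : Subalgebra ℝ (X → ℝ)) (pb : (X → ℝ) → (X → ℝ) → (X → ℝ)) : Prop where
  smooth : ∀ F ∈ A, IsGateauxSmooth F
  bracket_mem : ∀ F ∈ A, ∀ G ∈ A, pb F G ∈ A
  add_left : ∀ F ∈ A, ∀ G ∈ A, ∀ H ∈ A, pb (F + G) H = pb F H + pb G H
  smul_left : ∀ (c : ℝ), ∀ F ∈ A, ∀ G ∈ A, pb (c • F) G = c • pb F G
  add_right : ∀ F ∈ A, ∀ G ∈ A, ∀ H ∈ A, pb F (G + H) = pb F G + pb F H
  smul_right : ∀ (c : ℝ), ∀ F ∈ A, ∀ G ∈ A, pb F (c • G) = c • pb F G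
  antisymm : ∀ F ∈ A, ∀ G ∈ A, pb F G = -pb G F
  jacobi : ∀ F ∈ A, ∀ G ∈ A, ∀ H ∈ A, pb F (pb G H) + pb G (pb H F) + pb H (pb F G) = 0
  leibniz : ∀ F ∈ A, ∀ G ∈ A, ∀ H ∈ A, pb F (G * H) = H * pb F G + G * pb F H
  nondegenerate : ∀ x v : X, (∀ F ∈ A, gateauxDeriv F x v = 0) → v = 0
  hamiltonian : ∀ F ∈ A, ∃ V : X → X, IsGateauxSmooth V ∧
    ∀ G ∈ A, ∀ x, gateauxDeriv G x (V x) = pb G F x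

/-! Smooth functions on `(ℝ^{2d})^k` and their topology -/

/-- The configuration space `(ℝ^{2d})^k`; the `α`-th particle is `z α = (x, v)`. -/
abbrev Config (d k : ℕ) : Type := Fin k → (Fin d → ℝ) × (Fin d → ℝ)

/-- The algebra of smooth real functions on `(ℝ^{2d})^k`. -/
def smoothAlgebra (d k : ℕ) : Subalgebra ℝ (Config d k → ℝ) where
  carrier := {f | ContDiff ℝ ∞ f}
  mul_mem' := by
    intro f g (hf : ContDiff ℝ ∞ f) (hg : ContDiff ℝ ∞ g)
    exact hf.mul hg
  add_mem' := by
    intro f g (hf : ContDiff ℝ ∞ f) (hg : ContDiff ℝ ∞ g)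
    exact hf.add hg
  algebraMap_mem' := by
    intro c
    exact (contDiff_const : ContDiff ℝ ∞ (fun _ : Config d k => c))

/-- `C^∞((ℝ^{2d})^k)`. This is a separate type, so that it does not inherit the topology of
pointwise convergence. -/
def Smooth (d k : ℕ) : Type := ↥(smoothAlgebra d k)

namespace Smooth

variable {d k : ℕ}

instance : CommRing (Smooth d k) := inferInstanceAs (CommRing ↥(smoothAlgebra d k))

instance : Algebra ℝ (Smooth d k) := inferInstanceAs (Algebra ℝ ↥(smoothAlgebra d k))

instance : CoeFun (Smooth d k) (fun _ => Config d k → ℝ) := ⟨fun f => f.1⟩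

/-- Bundle a smooth function. -/
def mk (f : Config d k → ℝ) (hf : ContDiff ℝ ∞ f) : Smooth d k := ⟨f, hf⟩

@[ext] theorem ext {f g : Smooth d k} (h : ∀ z, f z = g z) : f = g := Subtype.ext (funext h)

theorem contDiff (f : Smooth d k) : ContDiff ℝ ∞ (f : Config d k → ℝ) := f.2

@[simp] theorem mk_apply (f : Config d k → ℝ) (hf : ContDiff ℝ ∞ f) (z : Config d k) :
    (mk f hf) z = f z := rfl

@[simp] theorem add_apply (f g : Smooth d k) (z : Config d k) : (f + g) z = f z + g z := rfl

@[simp] theorem mul_apply (f g : Smooth d k) (z : Config d k) : (f * g) z = f z * g z := rfl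

@[simp] theorem smul_apply (c : ℝ) (f : Smooth d k) (z : Config d k) :
    (c • f) z = c * f z := rfl

/-- The restriction of the `m`-th total derivative to a compact set. -/
def derivOn (K : Compacts (Config d k)) (m : ℕ) :
    Smooth d k →ₗ[ℝ] C(K, ContinuousMultilinearMap ℝ (fun _ : Fin m => Config d k) ℝ) where
  toFun f := ⟨fun z => iteratedFDeriv ℝ m f z,
    (f.contDiff.continuous_iteratedFDeriv (by exact_mod_cast le_top)).comp
      continuous_subtype_val⟩
  map_add' f g := by
    ext1 z
    exact iteratedFDeriv_add_apply (f.contDiff.contDiffAt.of_le (by exact_mod_cast le_top))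
      (g.contDiff.contDiffAt.of_le (by exact_mod_cast le_top))
  map_smul' c f := by
    ext1 z
    exact iteratedFDeriv_const_smul_apply
      (f.contDiff.contDiffAt.of_le (by exact_mod_cast le_top))

/-- The seminorms `ρ_{K,n}(f) = max_{m ≤ n} sup_{z ∈ K} ‖D^m f(z)‖`. -/
def rho (d k : ℕ) : SeminormFamily ℝ (Smooth d k) (Compacts (Config d k) × ℕ) :=
  fun p => (Finset.range (p.2 + 1)).sup fun m =>
    (normSeminorm ℝ C(p.1, ContinuousMultilinearMap ℝ (fun _ : Fin m => Config d k) ℝ)).comp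
      (derivOn p.1 m)

/-- The locally convex topology generated by the seminorms `ρ_{K,n}`. -/
instance : TopologicalSpace (Smooth d k) := (rho d k).moduleFilterBasis.topology

theorem withSeminorms_rho : WithSeminorms (rho d k) := ⟨rfl⟩

instance : IsTopologicalAddGroup (Smooth d k) := withSeminorms_rho.topologicalAddGroup

instance : ContinuousSMul ℝ (Smooth d k) := withSeminorms_rho.continuousSMul

/-- Relabelling: `f_{(σ(1),…,σ(m))}(z_1,…,z_k) = f(z_{σ(1)},…,z_{σ(m)})`. -/
def pull {m : ℕ} (σ : Fin m → Fin k) : Smooth d m →ₗ[ℝ] Smooth d k where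
  toFun f := mk (fun z => f (fun i => z (σ i)))
    (f.contDiff.comp (contDiff_pi.2 fun i => contDiff_apply ℝ _ (σ i)))
  map_add' _ _ := rfl
  map_smul' _ _ := rfl

/-- The derivative in the constant direction `w`. -/
def dirDeriv (w : Config d k) : Smooth d k →ₗ[ℝ] Smooth d k where
  toFun f := mk (fun z => fderiv ℝ f z w)
    ((f.contDiff.fderiv_right (by simp)).clm_apply contDiff_const)
  map_add' f g := by
    ext z
    have hf : DifferentiableAt ℝ f.1 z := f.contDiff.differentiable (by simp) z
    have hg : DifferentiableAt ℝ g.1 z := g.contDiff.differentiable (by simp) z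
    exact congrArg (fun L => L w) (fderiv_add hf hg)
  map_smul' c f := by
    ext z
    have hf : DifferentiableAt ℝ f.1 z := f.contDiff.differentiable (by simp) z
    exact congrArg (fun L => L w) (fderiv_const_smul hf c)

/-- `∂/∂x_α^i`. -/
def dX (α : Fin k) (i : Fin d) : Smooth d k →ₗ[ℝ] Smooth d k :=
  dirDeriv (Pi.single α (Pi.single i 1, 0))

/-- `∂/∂v_α^i`. -/
def dV (α : Fin k) (i : Fin d) : Smooth d k →ₗ[ℝ] Smooth d k :=
  dirDeriv (Pi.single α (0, Pi.single i 1))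

end Smooth

/-! Observables and states -/

/-- `𝔤_k`: the smooth functions invariant under permutation of the particles, with the topology
of `C^∞((ℝ^{2d})^k)`. -/
def Obs (d k : ℕ) : Submodule ℝ (Smooth d k) where
  carrier := {f | ∀ π : Equiv.Perm (Fin k), Smooth.pull π f = f}
  add_mem' := fun hf hg π => by rw [map_add, hf π, hg π]
  zero_mem' := fun π => map_zero _
  smul_mem' := fun c f hf π => by rw [map_smul, hf π]

/-- The symmetrization operator `Sym_k h = (1/k!) ∑_π h ∘ π`, with values in `𝔤_k`. -/
def symmetrize (d k : ℕ) : Smooth d k →ₗ[ℝ] Obs d k :=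
  LinearMap.codRestrict (Obs d k)
    ((k.factorial : ℝ)⁻¹ • ∑ π : Equiv.Perm (Fin k), Smooth.pull π) (fun f σ => by
      simp only [LinearMap.smul_apply, LinearMap.sum_apply, map_smul, map_sum]
      congr 1
      exact Fintype.sum_equiv (Equiv.mulLeft σ) _ _ (fun π => rfl))

/-- `𝔊_∞ = ⨁_{k ≥ 1} 𝔤_k`. The summand of index `n` is `𝔤_{n+1}`. -/
abbrev GInf (d : ℕ) : Type := ⨁ n : ℕ, Obs d (n + 1)

/-- `𝔊_∞^* = ∏_{k ≥ 1} 𝔤_k^*` with the product topology, each factor being the strong dual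
(topology of uniform convergence on bounded sets). The factor of index `n` is `𝔤_{n+1}^*`. -/
abbrev GInfStar (d : ℕ) : Type := (n : ℕ) → StrongDual ℝ (Obs d (n + 1))

/-- The duality pairing `⟨F, Γ⟩ = ∑_k ⟨f^{(k)}, γ^{(k)}⟩`. -/
def pairing {d : ℕ} (F : GInf d) (Γ : GInfStar d) : ℝ :=
  DirectSum.toModule ℝ ℕ ℝ (fun n => (Γ n : Obs d (n + 1) →ₗ[ℝ] ℝ)) F

/-! The Lie bracket of `𝔊_∞` -/

/-- The tuple `(α, ℓ+1, …, ℓ+j-1)` of length `j = b+1`, for `ℓ = a+1`; particle labels start at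
`0` here, so that its entries are `α, a+1, …, a+b`. -/
def skipTuple (a b : ℕ) {n : ℕ} (h : a + b < n) (α : Fin n) : Fin (b + 1) → Fin n :=
  fun i => if i = 0 then α else ⟨a + i, by omega⟩

/-- The tuple `(1, …, m)` in `{1, …, n}`. -/
def firstTuple {m n : ℕ} (h : m ≤ n) : Fin m → Fin n := Fin.castLE h

/-- For `ℓ = a+1`, `j = b+1` and `k = ℓ+j-1 = a+b+1`, the function `f ∧₁ g` on `(ℝ^{2d})^k`,
`ℓ j (∇_{x_1} f(z_1,…,z_ℓ) · ∇_{v_1} g(z_1,z_{ℓ+1},…,z_k)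
      - ∇_{x_1} g(z_1,…,z_j) · ∇_{v_1} f(z_1,z_{j+1},…,z_k))`. -/
def wedgeOne {d a b : ℕ} (f : Smooth d (a + 1)) (g : Smooth d (b + 1)) : Smooth d (a + b + 1) :=
  (((a + 1) * (b + 1) : ℕ) : ℝ) • ∑ i : Fin d,
    (Smooth.pull (firstTuple (by omega)) (Smooth.dX 0 i f) *
        Smooth.pull (skipTuple a b (by omega) 0) (Smooth.dV 0 i g) -
      Smooth.pull (firstTuple (by omega)) (Smooth.dX 0 i g) *
        Smooth.pull (skipTuple b a (by omega) 0) (Smooth.dV 0 i f))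

open scoped Classical in
/-- The Lie bracket of `𝔊_∞`, whose component of order `k` is
`∑_{ℓ+j-1=k} Sym_k (f^{(ℓ)} ∧₁ g^{(j)})`: the pair `ℓ = a+1`, `j = b+1` contributes to the
component of index `a+b`, that is, of order `k = a+b+1`. -/
def lieBracket {d : ℕ} (F G : GInf d) : GInf d :=
  ∑ a ∈ DFinsupp.support F, ∑ b ∈ DFinsupp.support G,
    DirectSum.of (fun n : ℕ => Obs d (n + 1)) (a + b)
      (symmetrize d (a + b + 1) (wedgeOne (F a : Smooth d (a + 1)) (G b : Smooth d (b + 1))))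

/-! The Lie-Poisson bracket and the algebra `𝒜_∞` -/

/-- `F` is the element of `𝔊_∞ ≅ 𝔊_∞^{**}` that is identified with the functional `d𝓕[Γ]`. -/
def RepresentsDeriv {d : ℕ} (𝓕 : GInfStar d → ℝ) (Γ : GInfStar d) (F : GInf d) : Prop :=
  ∀ Δ : GInfStar d, gateauxDeriv 𝓕 Γ Δ = pairing F Δ

/-- `d𝓕[Γ]` as an element of `𝔊_∞`. -/
def derivObs {d : ℕ} (𝓕 : GInfStar d → ℝ) (Γ : GInfStar d) : GInf d :=
  Classical.epsilon (RepresentsDeriv 𝓕 Γ)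

/-- `{𝓕, 𝓖}(Γ) = ⟨[d𝓕[Γ], d𝓖[Γ]], Γ⟩`. -/
def lpBracket (d : ℕ) (𝓕 𝓖 : GInfStar d → ℝ) : GInfStar d → ℝ :=
  fun Γ => pairing (lieBracket (derivObs 𝓕 Γ) (derivObs 𝓖 Γ)) Γ

/-- The algebra `𝒜_∞` generated by the expectation functionals `⟨F, ·⟩` and the constants. -/
def AInf (d : ℕ) : Subalgebra ℝ (GInfStar d → ℝ) :=
  Algebra.adjoin ℝ
    ({𝓕 | IsGateauxSmooth 𝓕 ∧ ∃ F : GInf d, 𝓕 = fun Γ => pairing F Γ} ∪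
      {𝓕 | IsGateauxSmooth 𝓕 ∧ ∃ c : ℝ, 𝓕 = fun _ => c})

/-! Distributions and the Hamiltonian vector field -/

/-- Linear functionals on `C^∞((ℝ^{2d})^k)`; the compactly supported distributions are the
continuous ones. The operations below act by transposition. -/
abbrev Dist (d k : ℕ) : Type := Smooth d k →ₗ[ℝ] ℝ

namespace Dist

variable {d k : ℕ}

/-- An element of `𝔤_k^*` as a symmetric distribution on `(ℝ^{2d})^k`. -/
def ofState (γ : StrongDual ℝ (Obs d k)) : Dist d k :=
  (γ : Obs d k →ₗ[ℝ] ℝ) ∘ₗ symmetrize d k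

/-- The product `h T` of a distribution and a smooth function. -/
def mulSmooth (h : Smooth d k) (T : Dist d k) : Dist d k := T ∘ₗ LinearMap.mulLeft ℝ h

/-- The distributional derivative `∂T/∂x_α^i`. -/
def dX (α : Fin k) (i : Fin d) (T : Dist d k) : Dist d k := -(T ∘ₗ Smooth.dX α i)

/-- The distributional derivative `∂T/∂v_α^i`. -/
def dV (α : Fin k) (i : Fin d) (T : Dist d k) : Dist d k := -(T ∘ₗ Smooth.dV α i)

/-- The standard Poisson bracket
`{h, T} = ∑_β (∇_{x_β} h · ∇_{v_β} T - ∇_{v_β} h · ∇_{x_β} T)` on `(ℝ^{2d})^k`. -/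
def poisson (h : Smooth d k) (T : Dist d k) : Dist d k :=
  ∑ β : Fin k, ∑ i : Fin d,
    (mulSmooth (Smooth.dX β i h) (dV β i T) - mulSmooth (Smooth.dV β i h) (dX β i T))

/-- The marginal `∫ dz_{m+1} ⋯ dz_k T`, given by `φ ↦ T(φ ⊗ 1^{⊗(k-m)})`. -/
def marginal {m : ℕ} (h : m ≤ k) (T : Dist d k) : Dist d m :=
  T ∘ₗ Smooth.pull (firstTuple h)

end Dist

/-- For `ℓ = a+1`, the component of order `ℓ` of the Hamiltonian vector field of `𝓖` at `Γ`:
`∑_j j ∫ dz_{ℓ+1} ⋯ dz_{ℓ+j-1} {∑_{α=1}^ℓ d𝓖[Γ]^{(j)}_{(α,ℓ+1,…,ℓ+j-1)}, γ^{(ℓ+j-1)}}`,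
where `j = b+1`. Only finitely many terms are nonzero. -/
def hamField {d : ℕ} (𝓖 : GInfStar d → ℝ) (Γ : GInfStar d) (a : ℕ) : Dist d (a + 1) :=
  ∑ᶠ b : ℕ, ((b + 1 : ℕ) : ℝ) •
    Dist.marginal (m := a + 1) (k := a + b + 1) (by omega)
      (Dist.poisson
        (∑ α : Fin (a + 1),
          Smooth.pull (skipTuple a b (by omega) (Fin.castLE (by omega) α))
            (derivObs 𝓖 Γ b : Smooth d (b + 1)))
        (Dist.ofState (Γ (a + b))))

end VlasovHierarchy

end

/-!
Why the theorem holds.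

The duality. The Gateaux derivative of a smooth functional is linear in the direction, by the mean
value theorem on short segments (`IsGateauxSmooth.deriv_add`), so it is a continuous functional on
the product `𝔊_∞^*` and only sees finitely many factors. On one factor it is an evaluation, because
`𝔤_k` is reflexive: sets of smooth functions with bounded seminorms are compact
(`Smooth.isCompact_bounded`), so a functional that is bounded by the supremum over such a set is an
evaluation at one of its points, by Hahn-Banach in finite dimensions and compactness
(`exists_eval_of_compact_hull`). Point evaluations give uniqueness.

The Lie algebra. For `N` particles at `z_1, …, z_N`, integrate an observable of order `n+1` against
the power `μ^{⊗(n+1)}` of the measure `μ = ∑_i δ_{z_i}`, and multiply the result by `c^n`. The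
resulting maps `fock N c` from `𝔊_∞` to smooth functions on `(ℝ^{2d})^N` carry the bracket of
`𝔊_∞` to the standard Poisson bracket (`fock_lieBracket`): differentiation in `z_β` selects the
tuples in which the particle `β` occurs, and a product of two such terms is a sum over tuples that
overlap in `β`, as in `f ∧₁ g`. Jointly in `N` and `c` these maps are injective (`eq_of_fock_eq`):
the powers of `c` separate the orders, and inclusion-exclusion over sets of particles recovers
a symmetric function. Hence bilinearity, antisymmetry and the Jacobi identity in `𝔊_∞` follow from
those of the Poisson bracket, where the Jacobi identity only uses commuting derivations.

The Hamiltonian vector field. The transpose `coad G` of `F ↦ [F, G]` is a continuous linear map of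
`𝔊_∞^*`, and `X_𝓖(Γ) = coad (d𝓖[Γ]) Γ`. Integration by parts, and relabelling of the particles under
the symmetric state, identify it with the explicit formula (`smul_marginal_poisson_apply`).

The Poisson algebra. On the generators `⟨F, ·⟩` of `𝒜_∞` the Lie-Poisson bracket is the bracket of
`𝔊_∞`. It is a derivation in each argument, and so is its Jacobiator, so closure of `𝒜_∞` and the
Jacobi identity reduce to generators. Smoothness of the fields `X_𝓖` reduces to generators as well,
through the product rule for Gateaux smooth maps (`IsGateauxSmooth.smul`).
-/

noncomputable section

namespace VlasovHierarchy

/-! ### Gateaux calculus -/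

section GateauxCalculus

variable {X Y : Type*} [AddCommGroup X] [Module ℝ X]
  [AddCommGroup Y] [Module ℝ Y] [TopologicalSpace Y]

namespace HasGateauxDeriv

theorem gateauxDeriv_eq [T2Space Y] {f : X → Y} {x v : X} {y : Y}
    (h : HasGateauxDeriv f x v y) : gateauxDeriv f x v = y :=
  h.limUnder_eq

theorem unique [T2Space Y] {f : X → Y} {x v : X} {y y' : Y}
    (h : HasGateauxDeriv f x v y) (h' : HasGateauxDeriv f x v y') : y = y' :=
  tendsto_nhds_unique h h'

theorem const (c : Y) (x v : X) : HasGateauxDeriv (fun _ : X => c) x v 0 := by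
  simp only [HasGateauxDeriv, sub_self, smul_zero]
  exact tendsto_const_nhds

theorem add [ContinuousAdd Y] {f g : X → Y} {x v : X} {a b : Y} (hf : HasGateauxDeriv f x v a)
    (hg : HasGateauxDeriv g x v b) : HasGateauxDeriv (fun y => f y + g y) x v (a + b) := by
  refine (Tendsto.add hf hg).congr fun h => ?_
  rw [← smul_add, add_sub_add_comm]

theorem smul [IsTopologicalAddGroup Y] [ContinuousSMul ℝ Y] {f : X → ℝ} {g : X → Y} {x v : X}
    {a : ℝ} {b : Y} (hf : HasGateauxDeriv f x v a) (hg : HasGateauxDeriv g x v b)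
    (hc : Tendsto (fun h : ℝ => g (x + h • v)) (𝓝[≠] 0) (𝓝 (g x))) :
    HasGateauxDeriv (fun y => f y • g y) x v (a • g x + f x • b) := by
  refine ((Tendsto.smul hf hc).add (Tendsto.smul (tendsto_const_nhds (x := f x)) hg)).congr
    fun h => ?_
  simp only [smul_sub, sub_smul, smul_eq_mul, mul_smul]
  rw [smul_comm (f x) h⁻¹ (g (x + h • v)), smul_comm (f x) h⁻¹ (g x)]
  abel

theorem map_linear [TopologicalSpace X] (L : X →L[ℝ] Y) (x v : X) :
    HasGateauxDeriv (fun y => L y) x v (L v) := by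
  refine (tendsto_const_nhds (x := L v)).congr' ?_
  filter_upwards [self_mem_nhdsWithin] with h (hh : h ≠ 0)
  rw [map_add, add_sub_cancel_left, map_smul, smul_smul, inv_mul_cancel₀ hh, one_smul]

/-- A Gateaux derivative is homogeneous in the direction. -/
theorem const_smul_dir [IsTopologicalAddGroup Y] [ContinuousSMul ℝ Y] {f : X → Y} {x v : X}
    {y : Y} (hf : HasGateauxDeriv f x v y) (c : ℝ) : HasGateauxDeriv f x (c • v) (c • y) := by
  rcases eq_or_ne c 0 with rfl | hc
  · simp only [HasGateauxDeriv, zero_smul, smul_zero, add_zero, sub_self]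
    exact tendsto_const_nhds
  · have hlim : Tendsto (fun h : ℝ => h * c) (𝓝[≠] 0) (𝓝[≠] 0) := by
      refine tendsto_nhdsWithin_iff.2 ⟨?_, ?_⟩
      · have : Tendsto (fun h : ℝ => h * c) (𝓝 0) (𝓝 (0 * c)) := by
          exact (continuous_id.mul continuous_const).tendsto 0
        rw [zero_mul] at this
        exact this.mono_left nhdsWithin_le_nhds
      · filter_upwards [self_mem_nhdsWithin] with h (hh : h ≠ 0)
        exact mul_ne_zero hh hc
    refine ((Tendsto.comp hf hlim).const_smul c).congr' ?_
    filter_upwards [self_mem_nhdsWithin] with h (hh : h ≠ 0)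
    simp only [Function.comp_apply, smul_smul, mul_inv]
    congr 1
    field_simp

end HasGateauxDeriv

theorem tendsto_along_line {Z : Type*} [TopologicalSpace X] [TopologicalSpace Z]
    [ContinuousAdd X] [ContinuousSMul ℝ X] {g : X → Z}
    (hg : Continuous g) (x v : X) :
    Tendsto (fun h : ℝ => g (x + h • v)) (𝓝[≠] 0) (𝓝 (g x)) := by
  have h : Continuous fun h : ℝ => g (x + h • v) :=
    hg.comp (continuous_const.add (continuous_id.smul continuous_const))
  have h0 := h.tendsto 0
  simp only [zero_smul, add_zero] at h0
  exact h0.mono_left nhdsWithin_le_nhds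

namespace IsGateauxSmooth

variable [TopologicalSpace X]

/-- Coinduction principle: a class of continuous families `G : X × Xⁿ → Y` that is closed under
differentiation consists of smooth functions in degree `n = 0`. -/
theorem of_closed (P : (n : ℕ) → (X → (Fin n → X) → Y) → Prop)
    (hc : ∀ n G, P n G → Continuous fun p : X × (Fin n → X) => G p.1 p.2)
    (hd : ∀ n G, P n G → ∃ G', P (n + 1) G' ∧
      ∀ x (v : Fin n → X) (w : X), HasGateauxDeriv (fun y => G y v) x w (G' x (Fin.snoc v w)))
    {f : X → Y} (h0 : P 0 fun x _ => f x) : IsGateauxSmooth f := by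
  let D : (n : ℕ) → {G // P n G} := fun n =>
    Nat.rec ⟨_, h0⟩ (fun n G => ⟨(hd n G.1 G.2).choose, (hd n G.1 G.2).choose_spec.1⟩) n
  exact ⟨fun n => (D n).1, fun _ _ => rfl, fun n => (hd n (D n).1 (D n).2).choose_spec.2,
    fun n => hc n _ (D n).2⟩

theorem continuous {f : X → Y} (hf : IsGateauxSmooth f) : Continuous f := by
  obtain ⟨D, h0, -, hc⟩ := hf
  have h : Continuous fun x : X => D 0 x Fin.elim0 :=
    (hc 0).comp (continuous_id.prodMk continuous_const)
  simpa only [h0] using h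

theorem exists_deriv {f : X → Y} (hf : IsGateauxSmooth f) :
    ∃ D : X → X → Y, (∀ x v, HasGateauxDeriv f x v (D x v)) ∧
      Continuous fun p : X × X => D p.1 p.2 := by
  obtain ⟨D, h0, hd, hc⟩ := hf
  refine ⟨fun x v => D 1 x fun _ => v, fun x v => ?_, ?_⟩
  · have h := hd 0 x Fin.elim0 v
    simp only [h0] at h
    convert h using 2
    ext i
    rw [Subsingleton.elim i (Fin.last 0), Fin.snoc_last]
  · exact (hc 1).comp (continuous_fst.prodMk (continuous_pi fun _ => continuous_snd))

theorem add [ContinuousAdd Y] {f g : X → Y} (hf : IsGateauxSmooth f) (hg : IsGateauxSmooth g) :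
    IsGateauxSmooth fun x => f x + g x := by
  obtain ⟨D, h0, hd, hc⟩ := hf
  obtain ⟨E, k0, kd, kc⟩ := hg
  exact ⟨fun n x v => D n x v + E n x v, fun x v => congrArg₂ _ (h0 x v) (k0 x v),
    fun n x v w => (hd n x v w).add (kd n x v w), fun n => (hc n).add (kc n)⟩

theorem const (c : Y) : IsGateauxSmooth fun _ : X => c :=
  of_closed (fun _ G => ∃ c, G = fun _ _ => c)
    (by rintro n _ ⟨c, rfl⟩; exact continuous_const)
    (by
      rintro n _ ⟨c, rfl⟩
      exact ⟨_, ⟨0, rfl⟩, fun x _ w => HasGateauxDeriv.const c x w⟩)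
    ⟨c, rfl⟩

theorem map_linear (L : X →L[ℝ] Y) : IsGateauxSmooth fun x => L x := by
  refine of_closed (fun n G => (G = fun x _ => L x) ∨
    ∃ g : (Fin n → X) → Y, Continuous g ∧ G = fun _ v => g v) ?_ ?_ (Or.inl rfl)
  · rintro n _ (rfl | ⟨g, hg, rfl⟩)
    · exact L.continuous.comp continuous_fst
    · exact hg.comp continuous_snd
  · rintro n _ (rfl | ⟨g, hg, rfl⟩)
    · refine ⟨fun _ v => L (v (Fin.last n)),
        Or.inr ⟨_, L.continuous.comp (continuous_apply _), rfl⟩, fun x v w => ?_⟩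
      simp only [Fin.snoc_last]
      exact HasGateauxDeriv.map_linear L x w
    · exact ⟨fun _ _ => 0, Or.inr ⟨_, continuous_const, rfl⟩,
        fun x v w => HasGateauxDeriv.const _ x w⟩

/-- The product rule: each derivative of `f • g` is a finite sum of products
`dᵏf[x](v ∘ σ) • dˡg[x](v ∘ τ)`. -/
theorem smul [IsTopologicalAddGroup X] [ContinuousSMul ℝ X] [IsTopologicalAddGroup Y]
    [ContinuousSMul ℝ Y] {f : X → ℝ} {g : X → Y} (hf : IsGateauxSmooth f)
    (hg : IsGateauxSmooth g) : IsGateauxSmooth fun x => f x • g x := by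
  obtain ⟨D, h0, hd, hc⟩ := hf
  obtain ⟨E, k0, kd, kc⟩ := hg
  let S : (n : ℕ) → Set (X → (Fin n → X) → Y) := fun n =>
    {G | ∃ (k l : ℕ) (σ : Fin k → Fin n) (τ : Fin l → Fin n),
      G = fun x v => D k x (v ∘ σ) • E l x (v ∘ τ)}
  have hcomp : ∀ {n k : ℕ} (σ : Fin k → Fin n),
      Continuous fun p : X × (Fin n → X) => (p.1, p.2 ∘ σ) := fun σ =>
    continuous_fst.prodMk
      (continuous_pi fun i => (continuous_apply (σ i)).comp continuous_snd)
  refine of_closed (fun n G => G ∈ AddSubmonoid.closure (S n)) ?_ ?_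
    (AddSubmonoid.subset_closure ⟨0, 0, id, id, ?_⟩)
  · intro n G hG
    induction hG using AddSubmonoid.closure_induction with
    | mem G h =>
      obtain ⟨k, l, σ, τ, rfl⟩ := h
      exact ((hc k).comp (hcomp σ)).smul ((kc l).comp (hcomp τ))
    | zero => exact continuous_const
    | add G H _ _ hG hH => exact hG.add hH
  · intro n G hG
    induction hG using AddSubmonoid.closure_induction with
    | mem G h =>
      obtain ⟨k, l, σ, τ, rfl⟩ := h
      -- extend an index map by sending the new last index to the new last direction
      let ext : {m : ℕ} → (Fin m → Fin n) → Fin (m + 1) → Fin (n + 1) := fun ρ =>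
        Fin.snoc (α := fun _ => Fin (n + 1)) (fun i => (ρ i).castSucc) (Fin.last n)
      have hext : ∀ {m : ℕ} (ρ : Fin m → Fin n) (v : Fin n → X) (w : X),
          (Fin.snoc v w : Fin (n + 1) → X) ∘ ext ρ = Fin.snoc (v ∘ ρ) w := by
        intro m ρ v w
        ext i
        refine Fin.lastCases ?_ (fun i => ?_) i <;> simp [ext]
      have hcast : ∀ {m : ℕ} (ρ : Fin m → Fin n) (v : Fin n → X) (w : X),
          (Fin.snoc v w : Fin (n + 1) → X) ∘ (Fin.castSucc ∘ ρ) = v ∘ ρ := by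
        intro m ρ v w
        ext i
        simp
      refine ⟨(fun x v => D (k + 1) x (v ∘ ext σ) • E l x (v ∘ (Fin.castSucc ∘ τ))) +
        fun x v => D k x (v ∘ (Fin.castSucc ∘ σ)) • E (l + 1) x (v ∘ ext τ),
        add_mem (AddSubmonoid.subset_closure ⟨_, _, _, _, rfl⟩)
          (AddSubmonoid.subset_closure ⟨_, _, _, _, rfl⟩), fun x v w => ?_⟩
      simp only [Pi.add_apply, hext, hcast]
      have hE : Continuous fun y => E l y (v ∘ τ) :=
        (kc l).comp (continuous_id.prodMk continuous_const)
      exact (hd k x (v ∘ σ) w).smul (kd l x (v ∘ τ) w) (tendsto_along_line hE x w)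
    | zero => exact ⟨0, zero_mem _, fun x v w => HasGateauxDeriv.const _ x w⟩
    | add G H _ _ hG hH =>
      obtain ⟨G', hG', hG⟩ := hG
      obtain ⟨H', hH', hH⟩ := hH
      exact ⟨G' + H', add_mem hG' hH', fun x v w => (hG x v w).add (hH x v w)⟩
  · ext x v
    rw [h0, k0]

/-- The derivative of a smooth real function is additive in the direction, by the mean value
theorem on the segment from `x + hv` to `x + hv + hw` and the continuity of the derivative. -/
theorem deriv_add [IsTopologicalAddGroup X] [ContinuousSMul ℝ X] {f : X → ℝ} {D : X → X → ℝ}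
    (hD : ∀ x v, HasGateauxDeriv f x v (D x v)) (hc : Continuous fun p : X × X => D p.1 p.2)
    (x v w : X) : D x (v + w) = D x v + D x w := by
  have hline : ∀ (y u : X) (t : ℝ),
      HasDerivAt (fun t : ℝ => f (y + t • u)) (D (y + t • u) u) t := by
    intro y u t
    rw [hasDerivAt_iff_tendsto_slope_zero]
    refine (hD (y + t • u) u).congr fun h => ?_
    rw [add_smul, add_assoc]
  have hmvt : ∀ h : ℝ, ∃ θ ∈ Set.Ioo (0 : ℝ) 1,
      D (x + h • v + θ • h • w) (h • w) = f (x + h • v + h • w) - f (x + h • v) := by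
    intro h
    obtain ⟨θ, hθ, h1⟩ := exists_hasDerivAt_eq_slope
      (fun t : ℝ => f (x + h • v + t • h • w)) (fun t => D (x + h • v + t • h • w) (h • w))
      zero_lt_one (fun t _ => (hline _ _ t).continuousAt.continuousWithinAt)
      (fun t _ => hline _ _ t)
    exact ⟨θ, hθ, by simpa using h1⟩
  choose θ hθ hmvt using hmvt
  have hhom : ∀ (y u : X) (c : ℝ), D y (c • u) = c * D y u := fun y u c =>
    (hD y (c • u)).unique ((hD y u).const_smul_dir c)
  -- the intermediate points `x + h • v + (θ h * h) • w` tend to `x`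
  have hθ0 : Tendsto (fun h : ℝ => θ h * h) (𝓝 0) (𝓝 0) := by
    refine squeeze_zero_norm (fun h => ?_) tendsto_norm_zero
    rw [norm_mul, Real.norm_of_nonneg (hθ h).1.le]
    exact mul_le_of_le_one_left (norm_nonneg h) (hθ h).2.le
  have hlim : Tendsto (fun h : ℝ => D (x + h • v + (θ h * h) • w) w) (𝓝[≠] 0) (𝓝 (D x w)) := by
    have h1 : Tendsto (fun h : ℝ => (x + h • v + (θ h * h) • w, w)) (𝓝 0)
        (𝓝 (x + (0 : ℝ) • v + (0 : ℝ) • w, w)) :=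
      ((tendsto_const_nhds.add (tendsto_id.smul_const v)).add (hθ0.smul_const w)).prodMk_nhds
        tendsto_const_nhds
    have h2 := (hc.tendsto _).comp h1
    simp only [zero_smul, add_zero] at h2
    exact h2.mono_left nhdsWithin_le_nhds
  refine (hD x (v + w)).unique ((Tendsto.add (hD x v) hlim).congr' ?_)
  filter_upwards [self_mem_nhdsWithin] with h (hh : h ≠ 0)
  have h1 := hmvt h
  rw [hhom, smul_smul] at h1
  rw [smul_add, ← add_assoc, smul_eq_mul, smul_eq_mul]
  have h2 : D (x + h • v + (θ h * h) • w) w =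
      h⁻¹ * (f (x + h • v + h • w) - f (x + h • v)) := by
    rw [← h1, inv_mul_cancel_left₀ hh]
  rw [h2]
  ring

theorem exists_clm [IsTopologicalAddGroup X] [ContinuousSMul ℝ X] {f : X → ℝ}
    (hf : IsGateauxSmooth f) (x : X) : ∃ L : X →L[ℝ] ℝ, ∀ v, HasGateauxDeriv f x v (L v) := by
  obtain ⟨D, hD, hc⟩ := hf.exists_deriv
  exact ⟨{ toFun := D x
           map_add' := deriv_add hD hc x
           map_smul' := fun c v => (hD x (c • v)).unique ((hD x v).const_smul_dir c)
           cont := hc.comp (continuous_const.prodMk continuous_id) }, hD x⟩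

end IsGateauxSmooth

end GateauxCalculus

/-! ### Continuity of the operations on smooth functions -/

namespace Smooth

variable {d k l : ℕ}

theorem norm_iteratedFDeriv_le_rho (f : Smooth d k) {K : Compacts (Config d k)} {m n : ℕ}
    (hm : m ≤ n) {z : Config d k} (hz : z ∈ K) : ‖iteratedFDeriv ℝ m f z‖ ≤ rho d k (K, n) f :=
  (ContinuousMap.norm_coe_le_norm (derivOn K m f) ⟨z, hz⟩).trans
    (Seminorm.le_finset_sup_apply (p := fun m => (normSeminorm ℝ C(K,
      ContinuousMultilinearMap ℝ (fun _ : Fin m => Config d k) ℝ)).comp (derivOn K m))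
      (Finset.mem_range.2 (Nat.lt_succ_of_le hm)))

theorem rho_le {f : Smooth d k} {K : Compacts (Config d k)} {n : ℕ} {C : ℝ} (hC : 0 ≤ C)
    (h : ∀ m ≤ n, ∀ z ∈ K, ‖iteratedFDeriv ℝ m f z‖ ≤ C) : rho d k (K, n) f ≤ C :=
  Seminorm.finset_sup_apply_le hC fun m hm =>
    (ContinuousMap.norm_le _ hC).2 fun z =>
      h m (Nat.le_of_lt_succ (Finset.mem_range.1 hm)) z z.2

theorem continuous_of_bound (T : Smooth d k →ₗ[ℝ] Smooth d l)
    (h : ∀ (K : Compacts (Config d l)) (n : ℕ), ∃ (K' : Compacts (Config d k)) (n' : ℕ) (C : ℝ),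
      0 ≤ C ∧ ∀ f, ∀ m ≤ n, ∀ z ∈ K, ‖iteratedFDeriv ℝ m (T f) z‖ ≤ C * rho d k (K', n') f) :
    Continuous T := by
  refine WithSeminorms.continuous_of_isBounded withSeminorms_rho withSeminorms_rho T fun p => ?_
  obtain ⟨K', n', C, hC, hb⟩ := h p.1 p.2
  refine ⟨{(K', n')}, ⟨C, hC⟩, fun f => ?_⟩
  rw [Finset.sup_singleton]
  exact rho_le (mul_nonneg hC (apply_nonneg _ _)) fun m hm z hz => hb f m hm z hz

theorem continuous_pull (σ : Fin k → Fin l) : Continuous (pull (d := d) σ) := by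
  let L : Config d l →L[ℝ] Config d k :=
    ContinuousLinearMap.pi fun i => ContinuousLinearMap.proj (σ i)
  refine continuous_of_bound _ fun K n =>
    ⟨K.map L L.continuous, n, (1 + ‖L‖) ^ n, by positivity, fun f m hm z hz => ?_⟩
  have h1 : iteratedFDeriv ℝ m (pull σ f) z =
      (iteratedFDeriv ℝ m f (L z)).compContinuousLinearMap fun _ => L :=
    L.iteratedFDeriv_comp_right f.contDiff z (by exact_mod_cast le_top)
  rw [h1, mul_comm]
  refine (ContinuousMultilinearMap.norm_compContinuousLinearMap_le _ _).trans ?_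
  refine mul_le_mul (norm_iteratedFDeriv_le_rho f hm ?_) ?_ (by positivity) (apply_nonneg _ _)
  · exact Set.mem_image_of_mem L hz
  · rw [Finset.prod_const, Finset.card_univ, Fintype.card_fin]
    have h0 : 0 ≤ ‖L‖ := norm_nonneg L
    calc ‖L‖ ^ m ≤ (1 + ‖L‖) ^ m := by gcongr; linarith
      _ ≤ (1 + ‖L‖) ^ n := pow_le_pow_right₀ (by linarith) hm

theorem continuous_dirDeriv (w : Config d k) : Continuous (dirDeriv w) := by
  refine continuous_of_bound _ fun K n => ⟨K, n + 1, ‖w‖, norm_nonneg w, fun f m hm z hz => ?_⟩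
  have hf : ContDiff ℝ ∞ (fderiv ℝ (f : Config d k → ℝ)) := f.contDiff.fderiv_right (by simp)
  refine (norm_iteratedFDeriv_clm_apply_const (N := ∞) hf.contDiffAt
    (by exact_mod_cast le_top)).trans ?_
  rw [norm_iteratedFDeriv_fderiv]
  exact mul_le_mul_of_nonneg_left (norm_iteratedFDeriv_le_rho f (by omega) hz) (norm_nonneg w)

theorem continuous_mul_const (g : Smooth d k) : Continuous fun f : Smooth d k => f * g := by
  refine continuous_of_bound (LinearMap.mulRight ℝ g) fun K n =>
    ⟨K, n, 2 ^ n * rho d k (K, n) g, mul_nonneg (by positivity) (apply_nonneg _ _),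
      fun f m hm z hz => ?_⟩
  refine (norm_iteratedFDeriv_mul_le (N := ∞) f.contDiff g.contDiff z
    (by exact_mod_cast le_top)).trans ?_
  have h0 : 0 ≤ rho d k (K, n) g := apply_nonneg _ _
  have h1 : 0 ≤ rho d k (K, n) f := apply_nonneg _ _
  calc _ ≤ ∑ i ∈ Finset.range (m + 1), (m.choose i : ℝ) * rho d k (K, n) f * rho d k (K, n) g := by
        refine Finset.sum_le_sum fun i hi => ?_
        have hi' := Finset.mem_range.1 hi
        have hf : ‖iteratedFDeriv ℝ i f z‖ ≤ rho d k (K, n) f :=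
          norm_iteratedFDeriv_le_rho f (by omega) hz
        have hg : ‖iteratedFDeriv ℝ (m - i) g z‖ ≤ rho d k (K, n) g :=
          norm_iteratedFDeriv_le_rho g (by omega) hz
        gcongr
    _ = 2 ^ m * rho d k (K, n) g * rho d k (K, n) f := by
        rw [← Finset.sum_mul, ← Finset.sum_mul, ← Nat.cast_sum, Nat.sum_range_choose]
        push_cast
        ring
    _ ≤ 2 ^ n * rho d k (K, n) g * rho d k (K, n) f := by
        gcongr
        norm_num

theorem continuous_const_mul (g : Smooth d k) : Continuous fun f : Smooth d k => g * f := by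
  simpa only [mul_comm g] using continuous_mul_const g

theorem continuous_eval (z : Config d k) : Continuous fun f : Smooth d k => f z := by
  let L : Smooth d k →ₗ[ℝ] ℝ :=
    { toFun := fun f => f z, map_add' := fun _ _ => rfl, map_smul' := fun _ _ => rfl }
  refine WithSeminorms.continuous_normedSpace_rng ℝ withSeminorms_rho L
    ⟨{(⟨{z}, isCompact_singleton⟩, 0)}, 1, fun f => ?_⟩
  rw [Finset.sup_singleton, one_smul]
  have h := norm_iteratedFDeriv_le_rho f (K := ⟨{z}, isCompact_singleton⟩) (le_refl 0)
    (Set.mem_singleton z)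
  rw [norm_iteratedFDeriv_zero] at h
  exact h

instance : T2Space (Smooth d k) :=
  T2Space.of_injective_continuous (f := fun (f : Smooth d k) (z : Config d k) => f z)
    (fun _ _ h => Smooth.ext fun z => congrFun h z) (continuous_pi continuous_eval)

end Smooth

theorem coe_symmetrize {d k : ℕ} (f : Smooth d k) : (symmetrize d k f : Smooth d k) =
    (k.factorial : ℝ)⁻¹ • ∑ π : Equiv.Perm (Fin k), Smooth.pull π f := by
  change ((k.factorial : ℝ)⁻¹ • ∑ π : Equiv.Perm (Fin k), Smooth.pull (d := d) π :
    Smooth d k →ₗ[ℝ] Smooth d k) f = _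
  rw [LinearMap.smul_apply, LinearMap.sum_apply]

theorem continuous_symmetrize (d k : ℕ) : Continuous (symmetrize d k) := by
  refine continuous_induced_rng.2 ?_
  have h : Continuous fun f : Smooth d k =>
      (k.factorial : ℝ)⁻¹ • ∑ π : Equiv.Perm (Fin k), Smooth.pull π f :=
    (continuous_finsetSum Finset.univ fun π _ =>
      Smooth.continuous_pull (d := d) (π : Equiv.Perm (Fin k))).const_smul
        (k.factorial : ℝ)⁻¹
  exact h.congr fun f => (coe_symmetrize f).symm

theorem isClosed_obs (d k : ℕ) : IsClosed (Obs d k : Set (Smooth d k)) := by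
  have h : (Obs d k : Set (Smooth d k)) =
      ⋂ π : Equiv.Perm (Fin k), {f | Smooth.pull π f = f} := by
    ext f
    simp [Obs]
  rw [h]
  exact isClosed_iInter fun π => isClosed_eq (Smooth.continuous_pull π) continuous_id

/-! ### Bounded sets of smooth functions are relatively compact -/

namespace Smooth

variable {d k : ℕ}

instance (m : ℕ) : FiniteDimensional ℝ
    (ContinuousMultilinearMap ℝ (fun _ : Fin m => Config d k) ℝ) :=
  Module.Finite.of_injective
    (ContinuousMultilinearMap.toMultilinearMapLinear :
      ContinuousMultilinearMap ℝ (fun _ : Fin m => Config d k) ℝ →ₗ[ℝ] _)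
    ContinuousMultilinearMap.toMultilinearMap_injective

/-- On a set of functions with bounded seminorms, the `m`-th derivative is Lipschitz on each ball,
with a constant that depends only on the bounds. -/
theorem norm_iteratedFDeriv_sub_le {f : Smooth d k} (m : ℕ) {R M : ℝ}
    (hM : rho d k (⟨Metric.closedBall 0 R, isCompact_closedBall 0 R⟩, m + 1) f ≤ M)
    {y z : Config d k} (hy : ‖y‖ ≤ R) (hz : ‖z‖ ≤ R) :
    ‖iteratedFDeriv ℝ m f y - iteratedFDeriv ℝ m f z‖ ≤ M * ‖y - z‖ := by
  refine Convex.norm_image_sub_le_of_norm_fderiv_le (𝕜 := ℝ) (s := Metric.closedBall 0 R)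
    (fun x _ => ?_) (fun x hx => ?_) (convex_closedBall 0 R)
    (mem_closedBall_zero_iff.2 hz) (mem_closedBall_zero_iff.2 hy)
  · exact f.contDiff.differentiable_iteratedFDeriv (by exact_mod_cast WithTop.coe_lt_top m) x
  · rw [norm_fderiv_iteratedFDeriv]
    exact (norm_iteratedFDeriv_le_rho f le_rfl hx).trans hM

/-- Sets of smooth functions that are given by bounds on all seminorms are compact. Along an
ultrafilter all derivatives converge pointwise, hence locally uniformly by the Lipschitz bounds,
so the pointwise limits are the derivatives of a smooth function. -/
theorem isCompact_bounded (C : Compacts (Config d k) × ℕ → ℝ) :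
    IsCompact {f : Smooth d k | ∀ p, rho d k p f ≤ C p} := by
  refine isCompact_iff_ultrafilter_le_nhds.2 fun U hU => ?_
  have hUmem : ∀ᶠ f in (U : Filter (Smooth d k)), ∀ p, rho d k p f ≤ C p :=
    le_principal_iff.1 hU
  -- pointwise limits exist, since the derivatives take values in finite-dimensional spaces
  have hlim : ∀ (z : Config d k) (m : ℕ), ∃ g, Tendsto
      (fun f : Smooth d k => iteratedFDeriv ℝ m f z) (U : Filter (Smooth d k)) (𝓝 g) := by
    intro z m
    obtain ⟨g, -, hg⟩ := (isCompact_closedBall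
      (0 : ContinuousMultilinearMap ℝ (fun _ : Fin m => Config d k) ℝ)
      (C (⟨{z}, isCompact_singleton⟩, m))).ultrafilter_le_nhds
        (U.map fun f : Smooth d k => iteratedFDeriv ℝ m f z) (by
          refine le_principal_iff.2 (mem_map.2 ?_)
          filter_upwards [hUmem] with f hf
          exact mem_closedBall_zero_iff.2
            ((norm_iteratedFDeriv_le_rho f le_rfl (Set.mem_singleton z)).trans (hf _)))
    exact ⟨g, hg⟩
  choose g hg using hlim
  have hunif : ∀ m : ℕ, TendstoLocallyUniformly
      (fun (f : Smooth d k) z => iteratedFDeriv ℝ m f z) (fun z => g z m)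
      (U : Filter (Smooth d k)) := by
    intro m
    refine Metric.tendstoLocallyUniformly_iff.2 fun ε hε z₀ => ?_
    let R : ℝ := ‖z₀‖ + 1
    let M : ℝ := C (⟨Metric.closedBall 0 R, isCompact_closedBall 0 R⟩, m + 1)
    -- the limits inherit the Lipschitz bounds on the ball of radius `R` about the origin
    have hlip : ∀ y, ‖y‖ ≤ R → ‖g y m - g z₀ m‖ ≤ M * ‖y - z₀‖ := by
      intro y hy
      refine le_of_tendsto ((hg y m).sub (hg z₀ m)).norm ?_
      filter_upwards [hUmem] with f hf
      exact norm_iteratedFDeriv_sub_le m (hf _) hy (by simp [R])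
    let δ : ℝ := min 1 (ε / (3 * (|M| + 1)))
    have hδ : 0 < δ := lt_min one_pos (by positivity)
    have hδM : ∀ y : Config d k, ‖y - z₀‖ < δ → M * ‖y - z₀‖ < ε / 3 := by
      intro y hy
      calc M * ‖y - z₀‖ ≤ (|M| + 1) * ‖y - z₀‖ := by
            gcongr
            linarith [le_abs_self M]
        _ < (|M| + 1) * δ := by gcongr
        _ ≤ (|M| + 1) * (ε / (3 * (|M| + 1))) := by gcongr; exact min_le_right _ _
        _ = ε / 3 := by field_simp
    refine ⟨Metric.ball z₀ δ, Metric.ball_mem_nhds z₀ hδ, ?_⟩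
    filter_upwards [hUmem, Metric.tendsto_nhds.1 (hg z₀ m) (ε / 3) (by positivity)]
      with f hf hf0 y hy
    rw [Metric.mem_ball, dist_eq_norm] at hy
    have hyR : ‖y‖ ≤ R := by
      have h1 : ‖y‖ ≤ ‖y - z₀‖ + ‖z₀‖ := by simpa using norm_add_le (y - z₀) z₀
      have h2 : δ ≤ 1 := min_le_left _ _
      simp only [R]
      linarith
    have h1 : ‖iteratedFDeriv ℝ m f y - iteratedFDeriv ℝ m f z₀‖ ≤ M * ‖y - z₀‖ :=
      norm_iteratedFDeriv_sub_le m (hf _) hyR (by simp [R])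
    have h2 := hlip y hyR
    have h3 := hδM y hy
    rw [dist_comm, dist_eq_norm]
    rw [dist_eq_norm] at hf0
    have h4 : iteratedFDeriv ℝ m f y - g y m =
        (iteratedFDeriv ℝ m f y - iteratedFDeriv ℝ m f z₀) + (iteratedFDeriv ℝ m f z₀ - g z₀ m)
          - (g y m - g z₀ m) := by abel
    rw [h4]
    refine (norm_sub_le _ _).trans_lt ?_
    have h5 := norm_add_le (iteratedFDeriv ℝ m f y - iteratedFDeriv ℝ m f z₀)
      (iteratedFDeriv ℝ m f z₀ - g z₀ m)
    linarith
  have hderiv : ∀ (m : ℕ) (z : Config d k),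
      HasFDerivAt (fun y => g y m) (g z (m + 1)).curryLeft z := by
    intro m z
    refine hasFDerivAt_of_tendstoLocallyUniformlyOn (l := (U : Filter (Smooth d k)))
      (f := fun (f : Smooth d k) y => iteratedFDeriv ℝ m f y)
      (f' := fun (f : Smooth d k) y => (iteratedFDeriv ℝ (m + 1) f y).curryLeft)
      (g' := fun y => (g y (m + 1)).curryLeft)
      isOpen_univ ?_ (fun f y _ => ?_) (fun y _ => hg y m) (Set.mem_univ z)
    · rw [tendstoLocallyUniformlyOn_univ]
      exact (continuousMultilinearCurryLeftEquiv ℝ (fun _ : Fin (m + 1) => Config d k)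
        ℝ).isometry.uniformContinuous.comp_tendstoLocallyUniformly (hunif (m + 1))
    · exact ((contDiff_iff_ftaylorSeries (n := (⊤ : ℕ∞))).1 f.contDiff).fderiv m
        (by exact_mod_cast WithTop.coe_lt_top m) y
  have htaylor : HasFTaylorSeriesUpTo ((⊤ : ℕ∞) : WithTop ℕ∞)
      (fun z => (g z 0).curry0) fun z m => g z m :=
    ⟨fun _ => rfl, fun m _ => hderiv m,
      fun m _ => continuous_iff_continuousAt.2 fun z => (hderiv m z).continuousAt⟩
  let g₀ : Smooth d k := mk _ htaylor.contDiff
  have hg₀ : ∀ (m : ℕ) (z : Config d k), iteratedFDeriv ℝ m g₀ z = g z m := fun m z =>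
    (htaylor.eq_iteratedFDeriv (by exact_mod_cast le_top) z).symm
  have hU₀ : Tendsto id (U : Filter (Smooth d k)) (𝓝 g₀) := by
    refine ((withSeminorms_rho (d := d) (k := k)).tendsto_nhds id g₀).2 fun p ε hε => ?_
    have h1 : ∀ m ∈ Finset.range (p.2 + 1),
        ∀ᶠ f : Smooth d k in (U : Filter (Smooth d k)), ∀ z ∈ p.1,
        dist (g z m) (iteratedFDeriv ℝ m f z) < ε / 2 := fun m _ =>
      Metric.tendstoUniformlyOn_iff.1
        ((tendstoLocallyUniformlyOn_iff_tendstoUniformlyOn_of_compact p.1.isCompact).1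
          (hunif m).tendstoLocallyUniformlyOn) (ε / 2) (half_pos hε)
    filter_upwards [(Finset.eventually_all _).2 h1] with f hf
    refine (rho_le (half_pos hε).le fun m hm z hz => ?_).trans_lt (half_lt_self hε)
    have h2 := (hf m (Finset.mem_range.2 (Nat.lt_succ_of_le hm)) z hz).le
    rw [dist_comm, dist_eq_norm] at h2
    refine le_of_eq_of_le (congrArg norm ?_) h2
    have h3 := congrFun (congrArg DFunLike.coe (map_sub (derivOn p.1 m) f g₀)) ⟨z, hz⟩
    rw [← hg₀]
    exact h3
  refine ⟨g₀, fun p => ?_, hU₀⟩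
  refine le_of_tendsto ((withSeminorms_rho.continuous_seminorm p).continuousAt.tendsto.comp hU₀) ?_
  filter_upwards [hUmem] with f hf using hf p

end Smooth

/-! ### Reflexivity -/

open scoped Pointwise in
/-- If every bounded set lies in a compact absolutely convex set, then every continuous functional
on the strong dual is an evaluation. By Hahn-Banach in `ℝⁿ`, finitely many of the equations
`γ x = L γ` can be solved in a fixed compact set, so all of them can. -/
theorem exists_eval_of_compact_hull {E : Type*} [AddCommGroup E] [Module ℝ E] [TopologicalSpace E]
    [IsTopologicalAddGroup E] [ContinuousSMul ℝ E]
    (hE : ∀ B : Set E, Bornology.IsVonNBounded ℝ B →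
      ∃ K, B ⊆ K ∧ IsCompact K ∧ Convex ℝ K ∧ Balanced ℝ K ∧ (0 : E) ∈ K)
    (L : StrongDual ℝ E →L[ℝ] ℝ) : ∃ x, ∀ γ, L γ = γ x := by
  have hL : {γ : StrongDual ℝ E | |L γ| < 1} ∈ 𝓝 (0 : StrongDual ℝ E) := by
    have h : Tendsto (fun γ => |L γ|) (𝓝 0) (𝓝 |L 0|) := (L.continuous.abs).tendsto 0
    rw [map_zero, abs_zero] at h
    exact h (Iio_mem_nhds one_pos)
  obtain ⟨⟨B, V⟩, ⟨hB, hV⟩, hBV⟩ := ContinuousLinearMap.hasBasis_nhds_zero.mem_iff.1 hL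
  obtain ⟨r, hr, hrV⟩ := Metric.mem_nhds_iff.1 hV
  obtain ⟨K₀, hBK, hK₀, hconv, hbal, h0⟩ := hE B hB
  -- scaled so that the bound `c` on `K` gives the bound `c * r` on `B`
  let K : Set E := (1 / r) • K₀
  have hK : IsCompact K := hK₀.smul _
  have h0K : (0 : E) ∈ K := ⟨0, h0, smul_zero _⟩
  have hLK : ∀ (γ : StrongDual ℝ E) (c : ℝ), 0 < c → (∀ x ∈ K, γ x < c) → L γ < c := by
    intro γ c hc hγ
    have h1 : |L (c⁻¹ • γ)| < 1 := by
      refine hBV fun x hx => hrV ?_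
      have hxK : (1 / r) • x ∈ K := Set.smul_mem_smul_set (hBK hx)
      have hxK' : (1 / r) • -x ∈ K := Set.smul_mem_smul_set (hbal.neg_mem_iff.2 (hBK hx))
      have h1 := hγ _ hxK
      have h2 := hγ _ hxK'
      rw [map_smul, map_neg, smul_eq_mul] at h2
      rw [map_smul, smul_eq_mul] at h1
      rw [mem_ball_zero_iff, Real.norm_eq_abs, smul_apply, smul_eq_mul,
        abs_mul, abs_of_pos (inv_pos.2 hc)]
      have h3 : 1 / r * |γ x| < c := by
        rcases abs_cases (γ x) with ⟨h, -⟩ | ⟨h, -⟩ <;> rw [h] <;> assumption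
      have h4 : |γ x| < c * r := by
        rw [div_mul_eq_mul_div, div_lt_iff₀ hr] at h3
        linarith [abs_nonneg (γ x)]
      rw [inv_mul_lt_iff₀ hc]
      exact h4
    rw [map_smul, smul_eq_mul, abs_mul, abs_of_pos (inv_pos.2 hc), inv_mul_lt_iff₀ hc,
      mul_one] at h1
    exact (le_abs_self _).trans_lt h1
  have hfin : ∀ u : Finset (StrongDual ℝ E), (K ∩ ⋂ γ ∈ u, {x : E | γ x = L γ}).Nonempty := by
    intro u
    classical
    let Φ : E →L[ℝ] (u → ℝ) := ContinuousLinearMap.pi fun γ => γ.1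
    by_cases hp : (fun γ : u => L γ.1) ∈ Φ '' K
    · obtain ⟨x, hx, hΦ⟩ := hp
      refine ⟨x, hx, Set.mem_iInter₂.2 fun γ hγ => ?_⟩
      exact congrFun hΦ ⟨γ, hγ⟩
    · exfalso
      obtain ⟨f, s, hfs, hsp⟩ := geometric_hahn_banach_closed_point
        ((hconv.smul (1 / r)).linear_image Φ.toLinearMap) (hK.image Φ.continuous).isClosed hp
      have hs : 0 < s := by simpa using hfs _ ⟨0, h0K, map_zero Φ⟩
      let c : u → ℝ := fun γ => f fun j => if γ = j then 1 else 0
      have hfsum : ∀ y : u → ℝ, f y = ∑ γ, y γ • c γ := fun y =>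
        f.toLinearMap.pi_apply_eq_sum_univ y
      have hLf : L (f.comp Φ) = f fun γ : u => L γ.1 := by
        have h1 : f.comp Φ = ∑ γ : u, c γ • γ.1 := by
          ext x
          rw [ContinuousLinearMap.comp_apply, hfsum, sum_apply]
          exact Finset.sum_congr rfl fun γ _ => mul_comm _ _
        rw [h1, map_sum, hfsum]
        refine Finset.sum_congr rfl fun γ _ => ?_
        rw [map_smul, smul_eq_mul, smul_eq_mul, mul_comm]
      have h2 := hLK (f.comp Φ) s hs fun x hx => hfs _ ⟨x, hx, rfl⟩
      rw [hLf] at h2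
      exact lt_asymm h2 hsp
  obtain ⟨x, -, hx⟩ := hK.inter_iInter_nonempty (fun γ : StrongDual ℝ E => {x : E | γ x = L γ})
    (fun γ => isClosed_eq γ.continuous continuous_const) hfin
  exact ⟨x, fun γ => (Set.mem_iInter.1 hx γ).symm⟩

theorem exists_compact_hull {d k : ℕ} (B : Set (Obs d k)) (hB : Bornology.IsVonNBounded ℝ B) :
    ∃ K, B ⊆ K ∧ IsCompact K ∧ Convex ℝ K ∧ Balanced ℝ K ∧ (0 : Obs d k) ∈ K := by
  have hB' : Bornology.IsVonNBounded ℝ ((Obs d k).subtypeL '' B) := hB.image _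
  rw [(Smooth.withSeminorms_rho (d := d) (k := k)).isVonNBounded_iff_seminorm_bounded] at hB'
  choose C hC hBC using hB'
  let q : Compacts (Config d k) × ℕ → Seminorm ℝ (Obs d k) := fun p =>
    (Smooth.rho d k p).comp (Obs d k).subtype
  refine ⟨⋂ p, (q p).closedBall 0 (C p), fun f hf => ?_, ?_,
    convex_iInter fun p => (q p).convex_closedBall _ _,
    balanced_iInter fun p => (q p).balanced_closedBall_zero _, ?_⟩
  · refine Set.mem_iInter.2 fun p => ?_
    rw [Seminorm.mem_closedBall_zero]
    exact (hBC p _ (Set.mem_image_of_mem _ hf)).le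
  · have h := (isClosed_obs d k).isClosedEmbedding_subtypeVal.isCompact_preimage
      (Smooth.isCompact_bounded C)
    refine Eq.subst (motive := IsCompact) (Set.ext fun f => ?_) h
    rw [Set.mem_iInter]
    exact forall_congr' fun p => by rw [Seminorm.mem_closedBall_zero]; rfl
  · refine Set.mem_iInter.2 fun p => ?_
    rw [Seminorm.mem_closedBall_zero, map_zero]
    exact (hC p).le

/-- `𝔤_k` is reflexive. -/
theorem exists_eval_eq {d k : ℕ} (L : StrongDual ℝ (Obs d k) →L[ℝ] ℝ) :
    ∃ f : Obs d k, ∀ γ, L γ = γ f :=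
  exists_eval_of_compact_hull exists_compact_hull L

/-! ### The duality between observables and states -/

section Pairing

variable {d : ℕ}

@[simp] theorem pairing_of (n : ℕ) (f : Obs d (n + 1)) (Γ : GInfStar d) :
    pairing (DirectSum.of (fun n : ℕ => Obs d (n + 1)) n f) Γ = Γ n f :=
  DirectSum.toModule_lof ℝ (φ := fun n => (Γ n : Obs d (n + 1) →ₗ[ℝ] ℝ)) n f

@[simp] theorem pairing_zero (Γ : GInfStar d) : pairing 0 Γ = 0 := map_zero _

theorem pairing_add (F G : GInf d) (Γ : GInfStar d) :
    pairing (F + G) Γ = pairing F Γ + pairing G Γ := map_add _ _ _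

theorem pairing_smul (c : ℝ) (F : GInf d) (Γ : GInfStar d) :
    pairing (c • F) Γ = c * pairing F Γ := map_smul _ _ _

theorem pairing_sum {ι : Type*} (s : Finset ι) (F : ι → GInf d) (Γ : GInfStar d) :
    pairing (∑ i ∈ s, F i) Γ = ∑ i ∈ s, pairing (F i) Γ := map_sum _ _ _

/-- The pairing with a fixed observable, as a continuous functional on the states. -/
def pairingCLM (F : GInf d) : GInfStar d →L[ℝ] ℝ where
  toFun Γ := pairing F Γ
  map_add' Γ Δ := by
    induction F using DirectSum.induction_on with
    | zero => simp
    | of n f => simp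
    | add F G hF hG => simp only [pairing_add, hF, hG]; ring
  map_smul' c Γ := by
    induction F using DirectSum.induction_on with
    | zero => simp
    | of n f => simp
    | add F G hF hG => simp only [pairing_add, hF, hG, smul_add]
  cont := by
    induction F using DirectSum.induction_on with
    | zero => simpa using continuous_const
    | of n f =>
      simp only [pairing_of]
      have h : Continuous fun γ : StrongDual ℝ (Obs d (n + 1)) => γ f := by fun_prop
      exact h.comp (continuous_apply n)
    | add F G hF hG => 
      simp only [pairing_add]
      exact hF.add hG

@[simp] theorem pairingCLM_apply (F : GInf d) (Γ : GInfStar d) :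
    pairingCLM F Γ = pairing F Γ := rfl

theorem pairing_single (F : GInf d) (n : ℕ) (γ : StrongDual ℝ (Obs d (n + 1))) :
    pairing F (Pi.single n γ) = γ (F n) := by
  induction F using DirectSum.induction_on with
  | zero => simp
  | of m f =>
    rw [pairing_of]
    rcases eq_or_ne m n with rfl | h
    · rw [Pi.single_eq_same, DirectSum.of_eq_same]
    · rw [Pi.single_eq_of_ne h, DirectSum.of_eq_of_ne _ _ _ h.symm, map_zero]
      rfl
  | add F G hF hG => rw [pairing_add, hF, hG, DirectSum.add_apply, map_add]

/-- Evaluation at a point of `(ℝ^{2d})^k`, as an element of `𝔤_k^*`. -/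
def evalCLM {k : ℕ} (z : Config d k) : StrongDual ℝ (Obs d k) where
  toFun f := (f : Smooth d k) z
  map_add' _ _ := rfl
  map_smul' _ _ := rfl
  cont := (Smooth.continuous_eval z).comp continuous_subtype_val

theorem eq_of_pairing_eq {F G : GInf d} (h : ∀ Γ, pairing F Γ = pairing G Γ) : F = G := by
  refine DFinsupp.ext fun n => Subtype.ext (Smooth.ext fun z => ?_)
  have h1 := h (Pi.single n (evalCLM z))
  rw [pairing_single, pairing_single] at h1
  exact h1

/-- `𝔊_∞` is the dual of `𝔊_∞^*`: a continuous functional on the product depends on finitely many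
components, and on each of them it is an evaluation. -/
theorem exists_pairing_eq (L : GInfStar d →L[ℝ] ℝ) : ∃ F : GInf d, ∀ Δ, L Δ = pairing F Δ := by
  have hL : {Δ : GInfStar d | |L Δ| < 1} ∈ 𝓝 (0 : GInfStar d) := by
    have h : Tendsto (fun Δ => |L Δ|) (𝓝 0) (𝓝 |L 0|) := (L.continuous.abs).tendsto 0
    rw [map_zero, abs_zero] at h
    exact h (Iio_mem_nhds one_pos)
  rw [nhds_pi, Filter.mem_pi'] at hL
  obtain ⟨I, t, ht, hI⟩ := hL
  -- otherwise a multiple of `Δ`, still in the neighbourhood, would have the value `1`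
  have hvanish : ∀ Δ : GInfStar d, (∀ n ∈ I, Δ n = 0) → L Δ = 0 := by
    intro Δ hΔ
    by_contra h
    have h1 : (L Δ)⁻¹ • Δ ∈ {Δ : GInfStar d | |L Δ| < 1} := by
      refine hI fun n hn => ?_
      rw [Pi.smul_apply, hΔ n hn, smul_zero]
      exact mem_of_mem_nhds (ht n)
    simp only [Set.mem_ofPred_eq, map_smul, smul_eq_mul, inv_mul_cancel₀ h] at h1
    norm_num at h1
  choose f hf using fun n : ℕ =>
    exists_eval_eq (L.comp (ContinuousLinearMap.single ℝ
      (fun n : ℕ => StrongDual ℝ (Obs d (n + 1))) n))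
  refine ⟨∑ n ∈ I, DirectSum.of (fun n : ℕ => Obs d (n + 1)) n (f n), fun Δ => ?_⟩
  have h1 : L (Δ - ∑ n ∈ I, Pi.single n (Δ n)) = 0 := by
    refine hvanish _ fun n hn => ?_
    rw [Pi.sub_apply, Finset.sum_apply, Finset.sum_eq_single n, Pi.single_eq_same]
    · exact sub_self (Δ n)
    · exact fun m _ hm => Pi.single_eq_of_ne hm.symm _
    · exact fun h => absurd hn h
  rw [sub_eq_zero.1 ((map_sub L _ _).symm.trans h1), map_sum, pairing_sum]
  exact Finset.sum_congr rfl fun n _ => by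
    rw [pairing_of]
    exact hf n (Δ n)

/-! ### Derivatives of functionals as observables -/

theorem derivObs_eq {𝓕 : GInfStar d → ℝ} {Γ : GInfStar d} {F : GInf d}
    (h : ∀ Δ, HasGateauxDeriv 𝓕 Γ Δ (pairing F Δ)) : derivObs 𝓕 Γ = F := by
  have h1 : RepresentsDeriv 𝓕 Γ F := fun Δ => (h Δ).gateauxDeriv_eq
  have h2 : RepresentsDeriv 𝓕 Γ (derivObs 𝓕 Γ) := Classical.epsilon_spec ⟨F, h1⟩
  exact eq_of_pairing_eq fun Δ => (h2 Δ).symm.trans (h1 Δ)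

theorem IsGateauxSmooth.hasGateauxDeriv_derivObs {𝓕 : GInfStar d → ℝ} (h : IsGateauxSmooth 𝓕)
    (Γ Δ : GInfStar d) : HasGateauxDeriv 𝓕 Γ Δ (pairing (derivObs 𝓕 Γ) Δ) := by
  obtain ⟨L, hL⟩ := h.exists_clm Γ
  obtain ⟨F, hF⟩ := exists_pairing_eq L
  have h1 : ∀ Δ, HasGateauxDeriv 𝓕 Γ Δ (pairing F Δ) := fun Δ => hF Δ ▸ hL Δ
  rw [derivObs_eq h1]
  exact h1 Δ

theorem IsGateauxSmooth.gateauxDeriv_eq {𝓕 : GInfStar d → ℝ} (h : IsGateauxSmooth 𝓕)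
    (Γ Δ : GInfStar d) : gateauxDeriv 𝓕 Γ Δ = pairing (derivObs 𝓕 Γ) Δ :=
  (h.hasGateauxDeriv_derivObs Γ Δ).gateauxDeriv_eq

theorem IsGateauxSmooth.existsUnique_representsDeriv {𝓕 : GInfStar d → ℝ}
    (h : IsGateauxSmooth 𝓕) (Γ : GInfStar d) : ∃! F : GInf d, RepresentsDeriv 𝓕 Γ F :=
  ⟨derivObs 𝓕 Γ, h.gateauxDeriv_eq Γ, fun _ hF => eq_of_pairing_eq fun Δ =>
    (hF Δ).symm.trans (h.gateauxDeriv_eq Γ Δ)⟩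

theorem isGateauxSmooth_pairing (F : GInf d) : IsGateauxSmooth fun Γ => pairing F Γ :=
  IsGateauxSmooth.map_linear (X := GInfStar d) (Y := ℝ) (pairingCLM F)

theorem derivObs_pairing (F : GInf d) (Γ : GInfStar d) : derivObs (fun Γ => pairing F Γ) Γ = F := by
  have h : ∀ Δ, HasGateauxDeriv (fun Γ => pairing F Γ) Γ Δ (pairing F Δ) := fun Δ => by
    have h1 := HasGateauxDeriv.map_linear (pairingCLM F) Γ Δ
    simp only [pairingCLM_apply] at h1
    exact h1
  exact derivObs_eq h

theorem derivObs_const (c : ℝ) (Γ : GInfStar d) : derivObs (fun _ => c) Γ = 0 :=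
  derivObs_eq fun Δ => by
    rw [pairing_zero]
    exact HasGateauxDeriv.const c Γ Δ

theorem derivObs_add {𝓕 𝓖 : GInfStar d → ℝ} (hF : IsGateauxSmooth 𝓕) (hG : IsGateauxSmooth 𝓖)
    (Γ : GInfStar d) : derivObs (𝓕 + 𝓖) Γ = derivObs 𝓕 Γ + derivObs 𝓖 Γ :=
  derivObs_eq fun Δ => by
    rw [pairing_add]
    exact (hF.hasGateauxDeriv_derivObs Γ Δ).add (hG.hasGateauxDeriv_derivObs Γ Δ)

theorem derivObs_mul {𝓕 𝓖 : GInfStar d → ℝ} (hF : IsGateauxSmooth 𝓕) (hG : IsGateauxSmooth 𝓖)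
    (Γ : GInfStar d) :
    derivObs (𝓕 * 𝓖) Γ = 𝓖 Γ • derivObs 𝓕 Γ + 𝓕 Γ • derivObs 𝓖 Γ :=
  derivObs_eq fun Δ => by
    rw [pairing_add, pairing_smul, pairing_smul, mul_comm (𝓖 Γ)]
    exact (hF.hasGateauxDeriv_derivObs Γ Δ).smul (hG.hasGateauxDeriv_derivObs Γ Δ)
      (tendsto_along_line hG.continuous Γ Δ)

theorem derivObs_smul (c : ℝ) {𝓕 : GInfStar d → ℝ} (hF : IsGateauxSmooth 𝓕) (Γ : GInfStar d) :
    derivObs (c • 𝓕) Γ = c • derivObs 𝓕 Γ := by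
  have h := derivObs_mul (IsGateauxSmooth.const c) hF Γ
  rw [derivObs_const, smul_zero, zero_add] at h
  exact h

end Pairing

/-! ### The Poisson bracket of smooth functions -/

/-- A bracket `∑ₚ (Dₚ f * Eₚ g - Dₚ g * Eₚ f)` that is built from commuting derivations of a
commutative algebra satisfies the Jacobi identity. The terms of the Jacobiator that are indexed by
`(p, q)` cancel against those indexed by `(q, p)`. -/
theorem jacobi_of_commuting_derivations {ι A : Type*} [Fintype ι] [CommRing A] [Algebra ℝ A]
    (D E : ι → A →ₗ[ℝ] A) (hD : ∀ p a b, D p (a * b) = D p a * b + a * D p b)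
    (hE : ∀ p a b, E p (a * b) = E p a * b + a * E p b)
    (hDD : ∀ p q a, D p (D q a) = D q (D p a)) (hEE : ∀ p q a, E p (E q a) = E q (E p a))
    (hED : ∀ p q a, E p (D q a) = D q (E p a)) {B : A → A → A}
    (hB : ∀ f g, B f g = ∑ p, (D p f * E p g - D p g * E p f)) (f g h : A) :
    B f (B g h) + B g (B h f) + B h (B f g) = 0 := by
  let T : A → A → A → ι → ι → A := fun f g h p q =>
    D p f * (D q (E p g) * E q h + D q g * E p (E q h) -
      (D q (E p h) * E q g + D q h * E p (E q g))) -
    (D p (D q g) * E q h + D q g * D p (E q h) -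
      (D p (D q h) * E q g + D q h * D p (E q g))) * E p f
  have hT : ∀ f g h, B f (B g h) = ∑ p, ∑ q, T f g h p q := by
    intro f g h
    rw [hB f]
    refine Finset.sum_congr rfl fun p _ => ?_
    rw [hB g, map_sum, map_sum, Finset.mul_sum, Finset.sum_mul, ← Finset.sum_sub_distrib]
    refine Finset.sum_congr rfl fun q _ => ?_
    rw [map_sub, map_sub, hD, hD, hE, hE, hED, hED]
  let S : ι → ι → A := fun p q => T f g h p q + T g h f p q + T h f g p q
  have hS : ∀ p q, S p q + S q p = 0 := by
    intro p q
    -- fix one order of `p` and `q` in all iterated derivatives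
    simp only [S, T, hDD q p, hEE q p]
    ring
  have hsum : B f (B g h) + B g (B h f) + B h (B f g) = ∑ p, ∑ q, S p q := by
    simp only [hT, S, Finset.sum_add_distrib]
  have h2 : (2 : ℝ) • ∑ p, ∑ q, S p q = 0 := by
    rw [two_smul]
    nth_rewrite 2 [Finset.sum_comm]
    simp only [← Finset.sum_add_distrib, hS, Finset.sum_const_zero]
  rw [hsum]
  exact (smul_eq_zero.1 h2).resolve_left two_ne_zero

namespace Smooth

variable {d k l m : ℕ}

@[simp] theorem zero_apply (z : Config d k) : (0 : Smooth d k) z = 0 := rfl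

theorem sum_apply {ι : Type*} (s : Finset ι) (f : ι → Smooth d k) (z : Config d k) :
    (∑ i ∈ s, f i) z = ∑ i ∈ s, f i z :=
  map_sum (⟨⟨fun f : Smooth d k => f z, rfl⟩, fun _ _ => rfl⟩ : Smooth d k →+ ℝ) f s

@[simp] theorem pull_apply (σ : Fin m → Fin k) (f : Smooth d m) (z : Config d k) :
    pull σ f z = f (z ∘ σ) := rfl

theorem pull_pull (τ : Fin k → Fin l) (σ : Fin m → Fin k) (f : Smooth d m) :
    pull τ (pull σ f) = pull (τ ∘ σ) f := rfl

theorem pull_mul (σ : Fin m → Fin k) (f g : Smooth d m) :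
    pull σ (f * g) = pull σ f * pull σ g := rfl

theorem differentiable (f : Smooth d k) : Differentiable ℝ (f : Config d k → ℝ) :=
  f.contDiff.differentiable (by simp)

theorem dirDeriv_mul (w : Config d k) (f g : Smooth d k) :
    dirDeriv w (f * g) = dirDeriv w f * g + f * dirDeriv w g := by
  ext z
  have h : fderiv ℝ (fun z => f z * g z) z = f z • fderiv ℝ g z + g z • fderiv ℝ f z :=
    fderiv_fun_mul (f.differentiable z) (g.differentiable z)
  change fderiv ℝ (fun z => f z * g z) z w = fderiv ℝ f z w * g z + f z * fderiv ℝ g z w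
  rw [h]
  change f z * fderiv ℝ g z w + g z * fderiv ℝ f z w = _
  ring

theorem dirDeriv_comm (w w' : Config d k) (f : Smooth d k) :
    dirDeriv w (dirDeriv w' f) = dirDeriv w' (dirDeriv w f) := by
  ext z
  have hf : Differentiable ℝ (fderiv ℝ (f : Config d k → ℝ)) :=
    (f.contDiff.fderiv_right (m := ∞) (by simp)).differentiable (by simp)
  have h : ∀ w w' : Config d k,
      dirDeriv w (dirDeriv w' f) z = fderiv ℝ (fderiv ℝ f) z w w' := by
    intro w w'
    change fderiv ℝ (fun z => fderiv ℝ f z w') z w = _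
    rw [fderiv_clm_apply (hf z) (differentiableAt_const w')]
    simp
  rw [h, h]
  exact (f.contDiff.contDiffAt.isSymmSndFDerivAt
    (by rw [minSmoothness_of_isRCLikeNormedField]; exact ENat.LEInfty.out)).eq w w'

/-- The derivative with respect to the particle `α` in the direction `e` of `ℝ^{2d}`. -/
def partialDeriv (α : Fin k) (e : (Fin d → ℝ) × (Fin d → ℝ)) : Smooth d k →ₗ[ℝ] Smooth d k :=
  dirDeriv (Pi.single α e)

theorem partialDeriv_pull (e : (Fin d → ℝ) × (Fin d → ℝ)) (β : Fin k) (σ : Fin m → Fin k)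
    (f : Smooth d m) : partialDeriv β e (pull σ f) =
      ∑ r, if σ r = β then pull σ (partialDeriv r e f) else 0 := by
  ext z
  let L : Config d k →L[ℝ] Config d m :=
    ContinuousLinearMap.pi fun i => ContinuousLinearMap.proj (σ i)
  have h1 : fderiv ℝ (fun z => f (L z)) z = (fderiv ℝ f (L z)).comp L :=
    ((f.differentiable (L z)).hasFDerivAt.comp z L.hasFDerivAt).fderiv
  have h2 : L (Pi.single β e) = ∑ r, if σ r = β then Pi.single r e else 0 := by
    funext s
    rw [Finset.sum_apply, Finset.sum_eq_single s]
    · by_cases h : σ s = β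
      · subst h
        simp [L]
      · simp [L, h]
    · intro r _ hr
      by_cases h : σ r = β
      · rw [if_pos h, Pi.single_eq_of_ne hr.symm]
      · rw [if_neg h]
        rfl
    · exact fun h => absurd (Finset.mem_univ s) h
  change fderiv ℝ (fun z => f (L z)) z (Pi.single β e) = _
  rw [h1, ContinuousLinearMap.comp_apply, h2, map_sum, sum_apply]
  refine Finset.sum_congr rfl fun r _ => ?_
  by_cases h : σ r = β
  · rw [if_pos h, if_pos h]
    rfl
  · rw [if_neg h, if_neg h, map_zero]
    rfl

theorem partialDeriv_pull_of_injective (e : (Fin d → ℝ) × (Fin d → ℝ)) {σ : Fin m → Fin k}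
    (hσ : Function.Injective σ) (r : Fin m) (f : Smooth d m) :
    partialDeriv (σ r) e (pull σ f) = pull σ (partialDeriv r e f) := by
  rw [partialDeriv_pull, Finset.sum_eq_single r]
  · rw [if_pos rfl]
  · exact fun s _ hs => if_neg fun h => hs (hσ h)
  · exact fun h => absurd (Finset.mem_univ r) h

theorem partialDeriv_pull_of_notMem (e : (Fin d → ℝ) × (Fin d → ℝ)) {σ : Fin m → Fin k}
    {β : Fin k} (hβ : ∀ r, σ r ≠ β) (f : Smooth d m) : partialDeriv β e (pull σ f) = 0 := by
  rw [partialDeriv_pull]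
  exact Finset.sum_eq_zero fun r _ => if_neg (hβ r)

/-- The derivatives of a symmetric function with respect to the different particles are obtained
from each other by exchanging the particles. -/
theorem partialDeriv_obs {n : ℕ} (e : (Fin d → ℝ) × (Fin d → ℝ)) (f : Obs d (n + 1))
    (r : Fin (n + 1)) : partialDeriv r e (f : Smooth d (n + 1)) =
      pull (Equiv.swap 0 r) (partialDeriv 0 e (f : Smooth d (n + 1))) := by
  rw [← partialDeriv_pull_of_injective e (Equiv.injective _), Equiv.swap_apply_left,
    f.2 (Equiv.swap 0 r)]

/-- The Poisson bracket
`{f, g} = ∑_β (∇_{x_β} f · ∇_{v_β} g - ∇_{x_β} g · ∇_{v_β} f)` on `(ℝ^{2d})^k`. -/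
def poissonBracket : Smooth d k →ₗ[ℝ] Smooth d k →ₗ[ℝ] Smooth d k :=
  ∑ p : Fin k × Fin d,
    ((LinearMap.mul ℝ (Smooth d k)).compl₁₂ (dX p.1 p.2) (dV p.1 p.2) -
      ((LinearMap.mul ℝ (Smooth d k)).compl₁₂ (dX p.1 p.2) (dV p.1 p.2)).flip)

theorem poissonBracket_apply (f g : Smooth d k) : poissonBracket f g =
    ∑ p : Fin k × Fin d, (dX p.1 p.2 f * dV p.1 p.2 g - dX p.1 p.2 g * dV p.1 p.2 f) := by
  simp [poissonBracket, LinearMap.sum_apply]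

theorem poissonBracket_skew (f g : Smooth d k) : poissonBracket f g = -poissonBracket g f := by
  rw [poissonBracket_apply, poissonBracket_apply, ← Finset.sum_neg_distrib]
  exact Finset.sum_congr rfl fun p _ => by ring

theorem poissonBracket_jacobi (f g h : Smooth d k) :
    poissonBracket f (poissonBracket g h) + poissonBracket g (poissonBracket h f) +
      poissonBracket h (poissonBracket f g) = 0 :=
  jacobi_of_commuting_derivations (fun p : Fin k × Fin d => dX p.1 p.2) (fun p => dV p.1 p.2)
    (fun _ => dirDeriv_mul _) (fun _ => dirDeriv_mul _) (fun _ _ => dirDeriv_comm _ _)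
    (fun _ _ => dirDeriv_comm _ _) (fun _ _ => dirDeriv_comm _ _)
    (B := fun f g => poissonBracket f g) poissonBracket_apply f g h

end Smooth

/-! ### Sums over tuples of particles -/

section PartSum

variable {d n N : ℕ}

/-- The observable of `N` particles induced by a function of `n` particles,
`(z_1, …, z_N) ↦ ∑_σ f(z_{σ(1)}, …, z_{σ(n)})`, where `σ` ranges over all tuples of particles,
with repetitions. Equivalently, the integral of `f` against `μ^{⊗n}` for `μ = ∑_i δ_{z_i}`. -/
def partSum (N : ℕ) : Smooth d n →ₗ[ℝ] Smooth d N :=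
  ∑ σ : Fin n → Fin N, Smooth.pull σ

theorem partSum_apply (f : Smooth d n) :
    partSum N f = ∑ σ : Fin n → Fin N, Smooth.pull σ f :=
  LinearMap.sum_apply _ _ _

theorem partSum_pull_perm (π : Equiv.Perm (Fin n)) (f : Smooth d n) :
    partSum N (Smooth.pull π f) = partSum N f := by
  rw [partSum_apply, partSum_apply]
  exact Fintype.sum_equiv (Equiv.arrowCongr π.symm (Equiv.refl (Fin N))) _ _ fun σ => rfl

theorem partSum_symmetrize (f : Smooth d n) :
    partSum N (symmetrize d n f : Smooth d n) = partSum N f := by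
  rw [coe_symmetrize, map_smul, map_sum]
  simp only [partSum_pull_perm]
  rw [Finset.sum_const, Finset.card_univ, Fintype.card_perm, Fintype.card_fin,
    ← Nat.cast_smul_eq_nsmul ℝ, smul_smul,
    inv_mul_cancel₀ (Nat.cast_ne_zero.2 n.factorial_ne_zero), one_smul]

theorem partialDeriv_partSum (e : (Fin d → ℝ) × (Fin d → ℝ)) (β : Fin N) (f : Obs d (n + 1)) :
    Smooth.partialDeriv β e (partSum N (f : Smooth d (n + 1))) =
      ((n + 1 : ℕ) : ℝ) • ∑ σ : Fin (n + 1) → Fin N, if σ 0 = β then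
        Smooth.pull σ (Smooth.partialDeriv 0 e (f : Smooth d (n + 1))) else 0 := by
  rw [partSum_apply, map_sum]
  simp only [Smooth.partialDeriv_pull]
  rw [Finset.sum_comm]
  have h : ∀ r : Fin (n + 1), (∑ σ : Fin (n + 1) → Fin N, if σ r = β then
      Smooth.pull σ (Smooth.partialDeriv r e (f : Smooth d (n + 1))) else 0) =
      ∑ σ : Fin (n + 1) → Fin N, if σ 0 = β then
        Smooth.pull σ (Smooth.partialDeriv 0 e (f : Smooth d (n + 1))) else 0 := by
    intro r
    refine Fintype.sum_equiv
      (Equiv.arrowCongr (Equiv.swap 0 r).symm (Equiv.refl (Fin N))) _ _ fun σ => ?_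
    have h0 : (Equiv.arrowCongr (Equiv.swap 0 r).symm (Equiv.refl (Fin N)) σ) =
        σ ∘ Equiv.swap 0 r := rfl
    rw [h0, Function.comp_apply, Equiv.swap_apply_left, Smooth.partialDeriv_obs,
      Smooth.pull_pull]
  simp only [h]
  rw [Finset.sum_const, Finset.card_univ, Fintype.card_fin, Nat.cast_smul_eq_nsmul]

/-- A tuple `(m_0, …, m_{a+b})` amounts to a pair of tuples of lengths `a+1` and `b+1` with the
same first entry, namely `(m_0, …, m_a)` and `(m_0, m_{a+1}, …, m_{a+b})`. -/
theorem sum_tuple_eq_sum_pairs {ι M : Type*} [Fintype ι] [DecidableEq ι] [AddCommMonoid M]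
    {a b n : ℕ} (hn : n = a + b + 1) (h1 : a + 1 ≤ n) (h2 : a + b < n) {α : Fin n}
    (hα : (α : ℕ) = 0) (φ : (Fin (a + 1) → ι) → (Fin (b + 1) → ι) → M) :
    ∑ m : Fin n → ι, φ (m ∘ firstTuple h1) (m ∘ skipTuple a b h2 α) =
      ∑ σ : Fin (a + 1) → ι, ∑ τ : Fin (b + 1) → ι, if σ 0 = τ 0 then φ σ τ else 0 := by
  subst hn
  obtain rfl : α = 0 := Fin.ext hα
  rw [← Fintype.sum_prod_type', ← Finset.sum_filter]
  refine Finset.sum_bij' (fun m _ => (m ∘ firstTuple h1, m ∘ skipTuple a b h2 0))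
    (fun p _ t => if h : (t : ℕ) < a + 1 then p.1 ⟨t, h⟩ else p.2 ⟨t - a, by omega⟩)
    (fun m _ => ?_) (fun _ _ => Finset.mem_univ _) (fun m _ => ?_) (fun p hp => ?_)
    (fun m _ => rfl)
  · rw [Finset.mem_filter]
    refine ⟨Finset.mem_univ _, ?_⟩
    simp [firstTuple, skipTuple]
  · funext t
    by_cases h : (t : ℕ) < a + 1
    · simp [h, firstTuple]
    · have h0 : t.1 - a ≠ 0 := by omega
      have h3 : (⟨t.1 - a, by omega⟩ : Fin (b + 1)) ≠ 0 := fun h => h0 (congrArg Fin.val h)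
      simp only [h, dif_neg, not_false_eq_true, Function.comp_apply, skipTuple, h3, if_false]
      exact congrArg m (Fin.ext (by simp; omega))
  · have hp0 : p.1 0 = p.2 0 := (Finset.mem_filter.1 hp).2
    refine Prod.ext (funext fun i => ?_) (funext fun i => ?_)
    · exact dif_pos i.2
    · by_cases h : i = 0
      · subst h
        simpa [skipTuple] using hp0
      · have h0 : i.1 ≠ 0 := fun h' => h (Fin.ext h')
        simp only [Function.comp_apply, skipTuple, h, if_false]
        rw [dif_neg (by omega)]
        exact congrArg p.2 (Fin.ext (by simp))

/-- Summing over tuples of particles turns `f ∧₁ g` into the Poisson bracket of `N` particles. -/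
theorem partSum_wedgeOne {a b : ℕ} (f : Obs d (a + 1)) (g : Obs d (b + 1)) :
    partSum N (wedgeOne (f : Smooth d (a + 1)) (g : Smooth d (b + 1))) =
      Smooth.poissonBracket (partSum N (f : Smooth d (a + 1)))
        (partSum N (g : Smooth d (b + 1))) := by
  -- a sum over pairs of tuples with `σ 0 = τ 0` is sorted by the common entry `β`
  have hprod : ∀ {a b : ℕ} (u : Smooth d (a + 1)) (w : Smooth d (b + 1)) {n : ℕ}
      (hn : n = a + b + 1) (h1 : a + 1 ≤ n) (h2 : a + b < n) {α : Fin n} (hα : (α : ℕ) = 0),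
      partSum N (Smooth.pull (firstTuple h1) u * Smooth.pull (skipTuple a b h2 α) w) =
        ∑ β : Fin N, (∑ σ : Fin (a + 1) → Fin N, if σ 0 = β then Smooth.pull σ u else 0) *
          ∑ τ : Fin (b + 1) → Fin N, if τ 0 = β then Smooth.pull τ w else 0 := by
    intro a b u w n hn h1 h2 α hα
    rw [partSum_apply]
    refine (sum_tuple_eq_sum_pairs hn h1 h2 hα
      fun σ τ => Smooth.pull σ u * Smooth.pull τ w).trans ?_
    simp only [Finset.sum_mul_sum]
    rw [Finset.sum_comm]
    refine Eq.trans ?_ Finset.sum_comm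
    rw [Finset.sum_comm]
    refine Finset.sum_congr rfl fun σ _ => ?_
    rw [Finset.sum_comm]
    refine Finset.sum_congr rfl fun τ _ => ?_
    rw [Finset.sum_eq_single (σ 0)]
    · simp [eq_comm]
    · intro β _ hβ
      rw [if_neg (Ne.symm hβ), zero_mul]
    · exact fun h => absurd (Finset.mem_univ _) h
  rw [Smooth.poissonBracket_apply, Fintype.sum_prod_type, Finset.sum_comm, wedgeOne, map_smul,
    map_sum, Finset.smul_sum]
  refine Finset.sum_congr rfl fun i _ => ?_
  rw [map_sub, hprod _ _ rfl _ _ rfl, hprod _ _ (by omega) _ _ rfl, ← Finset.sum_sub_distrib,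
    Finset.smul_sum]
  refine Finset.sum_congr rfl fun β _ => ?_
  have hX : ∀ {n : ℕ} (f : Obs d (n + 1)), Smooth.dX β i (partSum N (f : Smooth d (n + 1))) =
      ((n + 1 : ℕ) : ℝ) • ∑ σ : Fin (n + 1) → Fin N, if σ 0 = β then
        Smooth.pull σ (Smooth.dX 0 i (f : Smooth d (n + 1))) else 0 :=
    fun f => partialDeriv_partSum _ β f
  have hV : ∀ {n : ℕ} (f : Obs d (n + 1)), Smooth.dV β i (partSum N (f : Smooth d (n + 1))) =
      ((n + 1 : ℕ) : ℝ) • ∑ σ : Fin (n + 1) → Fin N, if σ 0 = β then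
        Smooth.pull σ (Smooth.dV 0 i (f : Smooth d (n + 1))) else 0 :=
    fun f => partialDeriv_partSum _ β f
  rw [hX f, hX g, hV f, hV g]
  simp only [smul_mul_smul_comm]
  rw [smul_sub, Nat.cast_mul, mul_comm ((b + 1 : ℕ) : ℝ)]

/-- By inclusion-exclusion over the sets of particles, a symmetric function is determined by its
sums over tuples of particles. -/
theorem eq_zero_of_partSum_eq_zero (f : Obs d n)
    (hf : ∀ N, partSum N (f : Smooth d n) = 0) : f = 0 := by
  classical
  refine Subtype.ext (Smooth.ext fun z => ?_)
  change (f : Smooth d n) z = 0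
  let φ : (Fin n → Fin n) → ℝ := fun σ => (f : Smooth d n) (z ∘ σ)
  -- the tuples with values in `T` form the sum over tuples for the `#T` particles in `T`
  have hT : ∀ T : Finset (Fin n), (∑ σ : Fin n → Fin n, if ∀ i, σ i ∈ T then φ σ else 0) = 0 := by
    intro T
    have h1 := congrArg (fun g : Smooth d T.card => g fun i => z (T.equivFin.symm i)) (hf T.card)
    simp only [partSum_apply, Smooth.sum_apply, Smooth.pull_apply, Smooth.zero_apply] at h1
    refine Eq.trans ?_ h1
    rw [← Finset.sum_filter, Finset.sum_subtype (p := fun σ => ∀ i, σ i ∈ T) _ (by simp)]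
    refine Fintype.sum_equiv ((Equiv.subtypePiEquivPi (p := fun _ x => x ∈ T)).trans
      (Equiv.arrowCongr (Equiv.refl (Fin n)) T.equivFin)) _ _ fun σ => ?_
    refine congrArg (f : Smooth d n) (funext fun i => congrArg z ?_)
    exact congrArg Subtype.val (T.equivFin.symm_apply_apply ⟨σ.1 i, σ.2 i⟩).symm
  have hsum : ∑ T : Finset (Fin n), (-1 : ℝ) ^ T.card *
      (∑ σ : Fin n → Fin n, if ∀ i, σ i ∈ Tᶜ then φ σ else 0) = 0 :=
    Finset.sum_eq_zero fun T _ => by rw [hT, mul_zero]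
  -- the alternating sum over `T` leaves the surjective tuples, on which `f` takes the value `f z`
  have hsurj : ∀ σ : Fin n → Fin n, (∑ T : Finset (Fin n), (-1 : ℝ) ^ T.card *
      if ∀ i, σ i ∈ Tᶜ then φ σ else 0) =
        if Function.Surjective σ then (f : Smooth d n) z else 0 := by
    intro σ
    have h1 : ∀ T : Finset (Fin n), (∀ i, σ i ∈ Tᶜ) ↔ T ∈ ((Finset.univ.image σ)ᶜ).powerset := by
      intro T
      rw [Finset.mem_powerset, Finset.subset_compl_comm]
      simp [Finset.subset_iff]
    simp only [h1, mul_ite, mul_zero]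
    rw [Finset.sum_ite_mem, Finset.univ_inter, ← Finset.sum_mul]
    have h2 := congrArg (Int.cast : ℤ → ℝ)
      (Finset.sum_powerset_neg_one_pow_card (x := (Finset.univ.image σ)ᶜ))
    push_cast at h2
    rw [h2]
    have h3 : (Finset.univ.image σ)ᶜ = ∅ ↔ Function.Surjective σ := by
      rw [Finset.compl_eq_empty_iff, Finset.eq_univ_iff_forall]
      simp [Function.Surjective]
    by_cases h : Function.Surjective σ
    · rw [if_pos (h3.2 h), if_pos h, one_mul]
      have h4 := f.2 (Equiv.ofBijective σ (Finite.surjective_iff_bijective.1 h))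
      exact congrArg (fun g : Smooth d n => g z) h4
    · rw [if_neg (mt h3.1 h), if_neg h, zero_mul]
  simp only [Finset.mul_sum] at hsum
  rw [Finset.sum_comm, Finset.sum_congr rfl fun σ _ => hsurj σ, ← Finset.sum_filter,
    Finset.sum_const, nsmul_eq_mul] at hsum
  refine (mul_eq_zero.1 hsum).resolve_left (Nat.cast_ne_zero.2 (Finset.card_ne_zero.2 ⟨id, ?_⟩))
  simp [Function.surjective_id]

end PartSum

/-! ### The Lie algebra of observables -/

section Fock

variable {d : ℕ}

/-- The `N`-particle representation of an observable: the component of order `n+1` is summed over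
tuples of particles with the weight `c^n`. The free parameter `c` keeps the orders apart. -/
def fock (N : ℕ) (c : ℝ) : GInf d →ₗ[ℝ] Smooth d N :=
  DirectSum.toModule ℝ ℕ (Smooth d N) fun n => c ^ n • (partSum N ∘ₗ (Obs d (n + 1)).subtype)

theorem fock_of (N : ℕ) (c : ℝ) (n : ℕ) (f : Obs d (n + 1)) :
    fock N c (DirectSum.of (fun n : ℕ => Obs d (n + 1)) n f) =
      c ^ n • partSum N (f : Smooth d (n + 1)) :=
  DirectSum.toModule_lof ℝ
    (φ := fun n => c ^ n • (partSum N ∘ₗ (Obs d (n + 1)).subtype)) n f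

open scoped Classical in
theorem fock_eq_sum (N : ℕ) (c : ℝ) (F : GInf d) : fock N c F =
    ∑ n ∈ DFinsupp.support F, c ^ n • partSum N (F n : Smooth d (n + 1)) := by
  conv_lhs => rw [← DirectSum.sum_support_of F]
  rw [map_sum]
  exact Finset.sum_congr rfl fun n _ => fock_of N c n (F n)

theorem eq_of_fock_eq {F G : GInf d} (h : ∀ N c, fock N c F = fock N c G) : F = G := by
  classical
  rw [← sub_eq_zero]
  generalize hH : F - G = H
  have hH0 : ∀ N c, fock N c H = 0 := fun N c => by rw [← hH, map_sub, h, sub_self]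
  refine DFinsupp.ext fun n => eq_zero_of_partSum_eq_zero (H n) fun N => Smooth.ext fun z => ?_
  let p : Polynomial ℝ := ∑ n ∈ DFinsupp.support H,
    Polynomial.monomial n ((partSum N (H n : Smooth d (n + 1))) z)
  have hp : p = 0 := by
    refine Polynomial.funext fun c => ?_
    have h1 := congrArg (fun g : Smooth d N => g z) (hH0 N c)
    simp only [fock_eq_sum, Smooth.sum_apply, Smooth.smul_apply, Smooth.zero_apply] at h1
    rw [Polynomial.eval_finsetSum, Polynomial.eval_zero, ← h1]
    exact Finset.sum_congr rfl fun n _ => by rw [Polynomial.eval_monomial, mul_comm]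
  have h2 := congrArg (fun p => Polynomial.coeff p n) hp
  simp only [p, Polynomial.finsetSum_coeff, Polynomial.coeff_monomial, Polynomial.coeff_zero,
    Finset.sum_ite_eq'] at h2
  by_cases hn : n ∈ DFinsupp.support H
  · rw [if_pos hn] at h2
    exact h2
  · rw [DFinsupp.notMem_support_iff.1 hn]
    exact congrArg (fun g : Smooth d N => g z) (map_zero (partSum N))

/-- The `N`-particle representations are Lie algebra homomorphisms. Being jointly injective, they
transfer the Lie algebra axioms from the Poisson brackets to `𝔊_∞`. -/
theorem fock_lieBracket (N : ℕ) (c : ℝ) (F G : GInf d) :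
    fock N c (lieBracket F G) = Smooth.poissonBracket (fock N c F) (fock N c G) := by
  classical
  rw [fock_eq_sum N c F, fock_eq_sum N c G, lieBracket, map_sum, LinearMap.map_sum₂]
  refine Finset.sum_congr (by congr) fun a _ => ?_
  rw [map_sum, map_sum]
  refine Finset.sum_congr (by congr) fun b _ => ?_
  rw [fock_of, partSum_symmetrize, partSum_wedgeOne, LinearMap.map_smul₂, map_smul, smul_smul,
    pow_add]

theorem lieBracket_skew (F G : GInf d) : lieBracket F G = -lieBracket G F :=
  eq_of_fock_eq fun N c => by
    rw [map_neg, fock_lieBracket, fock_lieBracket, Smooth.poissonBracket_skew]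

theorem lieBracket_add_right (F G H : GInf d) :
    lieBracket F (G + H) = lieBracket F G + lieBracket F H :=
  eq_of_fock_eq fun N c => by simp only [fock_lieBracket, map_add]

theorem lieBracket_smul_right (c : ℝ) (F G : GInf d) :
    lieBracket F (c • G) = c • lieBracket F G :=
  eq_of_fock_eq fun N c => by simp only [fock_lieBracket, map_smul]

theorem lieBracket_zero_right (F : GInf d) : lieBracket F 0 = 0 := by
  simpa using lieBracket_smul_right 0 F 0

theorem lieBracket_jacobi (F G H : GInf d) :
    lieBracket F (lieBracket G H) + lieBracket G (lieBracket H F) +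
      lieBracket H (lieBracket F G) = 0 :=
  eq_of_fock_eq fun N c => by
    simp only [map_add, map_zero, fock_lieBracket, Smooth.poissonBracket_jacobi]

end Fock

/-! ### The coadjoint action and the formula for the Hamiltonian vector field -/

section HamField

variable {d : ℕ}

theorem symmetrize_pull_perm {k : ℕ} (π : Equiv.Perm (Fin k)) (f : Smooth d k) :
    symmetrize d k (Smooth.pull π f) = symmetrize d k f := by
  refine Subtype.ext ?_
  rw [coe_symmetrize, coe_symmetrize]
  congr 1
  exact Fintype.sum_equiv (Equiv.mulRight π) _ _ fun σ => rfl

namespace Dist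

theorem ofState_apply {k : ℕ} (γ : StrongDual ℝ (Obs d k)) (f : Smooth d k) :
    ofState γ f = γ (symmetrize d k f) := rfl

theorem ofState_pull_perm {k : ℕ} (γ : StrongDual ℝ (Obs d k)) (π : Equiv.Perm (Fin k))
    (f : Smooth d k) : ofState γ (Smooth.pull π f) = ofState γ f := by
  rw [ofState_apply, ofState_apply, symmetrize_pull_perm]

/-- Integration by parts: the terms with second derivatives of `h` cancel. -/
theorem poisson_apply {k : ℕ} (h : Smooth d k) (T : Dist d k) (ψ : Smooth d k) :
    poisson h T ψ = T (Smooth.poissonBracket ψ h) := by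
  rw [Smooth.poissonBracket_apply, Fintype.sum_prod_type, map_sum, poisson, LinearMap.sum_apply]
  refine Finset.sum_congr rfl fun β _ => ?_
  rw [map_sum, LinearMap.sum_apply]
  refine Finset.sum_congr rfl fun i _ => ?_
  have h1 : (mulSmooth (Smooth.dX β i h) (dV β i T) -
      mulSmooth (Smooth.dV β i h) (dX β i T)) ψ =
      -T (Smooth.dV β i (Smooth.dX β i h * ψ)) - -T (Smooth.dX β i (Smooth.dV β i h * ψ)) := rfl
  have hV : Smooth.dV β i (Smooth.dX β i h * ψ) =
      Smooth.dV β i (Smooth.dX β i h) * ψ + Smooth.dX β i h * Smooth.dV β i ψ :=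
    Smooth.dirDeriv_mul _ _ _
  have hX : Smooth.dX β i (Smooth.dV β i h * ψ) =
      Smooth.dV β i (Smooth.dX β i h) * ψ + Smooth.dV β i h * Smooth.dX β i ψ :=
    (Smooth.dirDeriv_mul _ _ _).trans
      (congrArg (fun u => u * ψ + _) (Smooth.dirDeriv_comm _ _ h))
  rw [h1, hV, hX, map_add, map_add, map_sub, mul_comm (Smooth.dX β i ψ)]
  ring

end Dist

theorem val_skipTuple {a b n : ℕ} (h : a + b < n) (α : Fin n) (i : Fin (b + 1)) :
    (skipTuple a b h α i : ℕ) = if (i : ℕ) = 0 then (α : ℕ) else a + i := by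
  simp only [skipTuple, Fin.ext_iff, Fin.val_zero]
  split_ifs <;> rfl

/-- The permutation that carries the labels `(0, …, b)` to `(0, a+1, …, a+b)` and
`(b+1, …, a+b)` to `(1, …, a)`. -/
def blockSwap (a b : ℕ) : Equiv.Perm (Fin (a + b + 1)) where
  toFun t := ⟨if t.1 = 0 then 0 else if t.1 ≤ b then a + t else t - b, by split_ifs <;> omega⟩
  invFun t := ⟨if t.1 = 0 then 0 else if t.1 ≤ a then b + t else t - a, by split_ifs <;> omega⟩
  left_inv t := by
    refine Fin.ext ?_
    have ht := t.2
    dsimp only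
    split_ifs <;> omega
  right_inv t := by
    refine Fin.ext ?_
    have ht := t.2
    dsimp only
    split_ifs <;> omega

theorem blockSwap_comp_firstTuple (a b : ℕ) (h : b + 1 ≤ a + b + 1) (h' : a + b < a + b + 1) :
    blockSwap a b ∘ firstTuple h = skipTuple a b h' 0 := by
  funext t
  refine Fin.ext ?_
  have ht := t.2
  simp only [blockSwap, firstTuple, val_skipTuple, Function.comp_apply, Equiv.coe_fn_mk,
    Fin.val_castLE, Fin.val_zero]
  split_ifs <;> omega

theorem blockSwap_comp_skipTuple (a b : ℕ) (h : a + 1 ≤ a + b + 1) (h' : b + a < a + b + 1) :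
    blockSwap a b ∘ skipTuple b a h' 0 = firstTuple h := by
  funext t
  refine Fin.ext ?_
  have ht := t.2
  simp only [blockSwap, firstTuple, val_skipTuple, Function.comp_apply, Equiv.coe_fn_mk,
    Fin.val_castLE, Fin.val_zero]
  split_ifs <;> omega

theorem swap_comp_firstTuple {a n : ℕ} (h : a + 1 ≤ n + 1) (α : Fin (a + 1)) :
    Equiv.swap 0 (Fin.castLE h α) ∘ firstTuple h = firstTuple h ∘ Equiv.swap 0 α := by
  funext t
  exact ((Fin.castLE_injective h).map_swap 0 α t).symm

theorem swap_comp_skipTuple {a b n : ℕ} (h : a + 1 ≤ n + 1) (h' : a + b < n + 1)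
    (α : Fin (a + 1)) :
    Equiv.swap 0 (Fin.castLE h α) ∘ skipTuple a b h' 0 = skipTuple a b h' (Fin.castLE h α) := by
  funext t
  have hα := α.2
  by_cases ht : (t : ℕ) = 0
  · have h1 : skipTuple a b h' 0 t = 0 := Fin.ext (by rw [val_skipTuple, if_pos ht])
    rw [Function.comp_apply, h1, Equiv.swap_apply_left]
    exact Fin.ext (by rw [val_skipTuple, if_pos ht])
  · have h1 : skipTuple a b h' 0 t = skipTuple a b h' (Fin.castLE h α) t :=
      Fin.ext (by rw [val_skipTuple, val_skipTuple, if_neg ht, if_neg ht])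
    rw [Function.comp_apply, h1]
    refine Equiv.swap_apply_of_ne_of_ne ?_ ?_
    · rw [Ne, Fin.ext_iff, val_skipTuple, if_neg ht, Fin.val_zero]
      omega
    · rw [Ne, Fin.ext_iff, val_skipTuple, if_neg ht, Fin.val_castLE]
      omega

theorem skipTuple_injective {a b n : ℕ} (h : a + b < n) {α : Fin n} (hα : (α : ℕ) ≤ a) :
    Function.Injective (skipTuple a b h α) := by
  intro s t hst
  have h1 := congrArg Fin.val hst
  refine Fin.ext ?_
  rw [val_skipTuple, val_skipTuple] at h1
  split_ifs at h1 <;> omega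

/-- The bracket of a function of the first `a+1` particles with `∑_α g(z_α, z_{a+1}, …, z_{a+b})`:
only the particles `α` that occur in both arguments contribute. -/
theorem poissonBracket_firstTuple_skipTuple {a b : ℕ} (φ : Smooth d (a + 1))
    (g : Smooth d (b + 1)) (h : a + 1 ≤ a + b + 1) (h' : a + b < a + b + 1) :
    Smooth.poissonBracket (Smooth.pull (firstTuple h) φ)
      (∑ α : Fin (a + 1), Smooth.pull (skipTuple a b h' (Fin.castLE h α)) g) =
    ∑ α : Fin (a + 1), ∑ i : Fin d,
      (Smooth.pull (firstTuple h) (Smooth.dX α i φ) *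
          Smooth.pull (skipTuple a b h' (Fin.castLE h α)) (Smooth.dV 0 i g) -
        Smooth.pull (skipTuple a b h' (Fin.castLE h α)) (Smooth.dX 0 i g) *
          Smooth.pull (firstTuple h) (Smooth.dV α i φ)) := by
  have hφ : ∀ (e : (Fin d → ℝ) × (Fin d → ℝ)) (α : Fin (a + 1)),
      Smooth.partialDeriv (Fin.castLE h α) e (Smooth.pull (firstTuple h) φ) =
        Smooth.pull (firstTuple h) (Smooth.partialDeriv α e φ) := fun e α =>
    Smooth.partialDeriv_pull_of_injective e (Fin.castLE_injective h) α φ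
  have hφ0 : ∀ (e : (Fin d → ℝ) × (Fin d → ℝ)) (β : Fin (a + b + 1)),
      β ∉ Set.range (Fin.castLE h) →
      Smooth.partialDeriv β e (Smooth.pull (firstTuple h) φ) = 0 := fun e β hβ =>
    Smooth.partialDeriv_pull_of_notMem e (fun r hr => hβ ⟨r, hr⟩) φ
  have hg : ∀ (e : (Fin d → ℝ) × (Fin d → ℝ)) (α : Fin (a + 1)),
      Smooth.partialDeriv (Fin.castLE h α) e
        (∑ α : Fin (a + 1), Smooth.pull (skipTuple a b h' (Fin.castLE h α)) g) =
        Smooth.pull (skipTuple a b h' (Fin.castLE h α)) (Smooth.partialDeriv 0 e g) := by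
    intro e α
    rw [map_sum, Finset.sum_eq_single α]
    · have h1 := Smooth.partialDeriv_pull_of_injective e
        (skipTuple_injective (b := b) h' (α := Fin.castLE h α)
          (Nat.le_of_lt_succ α.2)) 0 g
      exact h1
    · intro α' _ hα'
      refine Smooth.partialDeriv_pull_of_notMem e (fun r hr => ?_) g
      have h1 := congrArg Fin.val hr
      have hα := α.2
      rw [val_skipTuple] at h1
      split_ifs at h1
      · exact hα' (Fin.ext h1)
      · rw [Fin.val_castLE] at h1
        omega
    · exact fun h => absurd (Finset.mem_univ _) h
  rw [Smooth.poissonBracket_apply, Fintype.sum_prod_type]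
  refine (Fintype.sum_of_injective (Fin.castLE h) (Fin.castLE_injective h) _ _
    (fun β hβ => ?_) fun α => ?_).symm
  · refine Finset.sum_eq_zero fun i _ => ?_
    have h1 : Smooth.dX β i (Smooth.pull (firstTuple h) φ) = 0 := hφ0 _ β hβ
    have h2 : Smooth.dV β i (Smooth.pull (firstTuple h) φ) = 0 := hφ0 _ β hβ
    rw [h1, h2, zero_mul, mul_zero, sub_zero]
  · refine Finset.sum_congr rfl fun i _ => ?_
    exact (congrArg₂ (fun u w => u - w) (congrArg₂ (fun u w => u * w) (hφ _ α) (hg _ α))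
      (congrArg₂ (fun u w => u * w) (hg _ α) (hφ _ α))).symm

/-- Each term of the formula for the Hamiltonian vector field is dual to a term of the Lie
bracket. -/
theorem smul_marginal_poisson_apply {a b : ℕ} (φ : Obs d (a + 1)) (g : Obs d (b + 1))
    (γ : StrongDual ℝ (Obs d (a + b + 1))) (h : a + 1 ≤ a + b + 1) (h' : a + b < a + b + 1) :
    (((b + 1 : ℕ) : ℝ) • Dist.marginal h (Dist.poisson
      (∑ α : Fin (a + 1), Smooth.pull (skipTuple a b h' (Fin.castLE h α))
        (g : Smooth d (b + 1))) (Dist.ofState γ))) (φ : Smooth d (a + 1)) =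
      γ (symmetrize d (a + b + 1)
        (wedgeOne (φ : Smooth d (a + 1)) (g : Smooth d (b + 1)))) := by
  have h1 : Dist.marginal h (Dist.poisson
      (∑ α : Fin (a + 1), Smooth.pull (skipTuple a b h' (Fin.castLE h α))
        (g : Smooth d (b + 1))) (Dist.ofState γ)) (φ : Smooth d (a + 1)) =
      Dist.ofState γ (Smooth.poissonBracket
        (Smooth.pull (firstTuple h) (φ : Smooth d (a + 1))) (∑ α : Fin (a + 1),
          Smooth.pull (skipTuple a b h' (Fin.castLE h α)) (g : Smooth d (b + 1)))) :=
    Dist.poisson_apply _ _ _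
  have hα : ∀ (α : Fin (a + 1)) (e : (Fin d → ℝ) × (Fin d → ℝ)) (w : Smooth d (b + 1)),
      Smooth.pull (firstTuple h) (Smooth.partialDeriv α e (φ : Smooth d (a + 1))) *
        Smooth.pull (skipTuple a b h' (Fin.castLE h α)) w =
      Smooth.pull (Equiv.swap 0 (Fin.castLE h α))
        (Smooth.pull (firstTuple h) (Smooth.partialDeriv 0 e (φ : Smooth d (a + 1))) *
          Smooth.pull (skipTuple a b h' 0) w) := by
    intro α e w
    rw [Smooth.pull_mul, Smooth.pull_pull, Smooth.pull_pull, swap_comp_firstTuple,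
      swap_comp_skipTuple, Smooth.partialDeriv_obs, Smooth.pull_pull]
  -- exchanging the particles `0` and `α` reduces to `α = 0`; the block exchange then matches the
  -- two ways in which the second term of `f ∧₁ g` can be labelled
  have hterm : ∀ (α : Fin (a + 1)) (i : Fin d), Dist.ofState γ
      (Smooth.pull (firstTuple h) (Smooth.dX α i (φ : Smooth d (a + 1))) *
          Smooth.pull (skipTuple a b h' (Fin.castLE h α))
            (Smooth.dV 0 i (g : Smooth d (b + 1))) -
        Smooth.pull (skipTuple a b h' (Fin.castLE h α))
            (Smooth.dX 0 i (g : Smooth d (b + 1))) *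
          Smooth.pull (firstTuple h) (Smooth.dV α i (φ : Smooth d (a + 1)))) =
      Dist.ofState γ
        (Smooth.pull (firstTuple h) (Smooth.dX 0 i (φ : Smooth d (a + 1))) *
            Smooth.pull (skipTuple a b h' 0) (Smooth.dV 0 i (g : Smooth d (b + 1))) -
          Smooth.pull (firstTuple (by omega)) (Smooth.dX 0 i (g : Smooth d (b + 1))) *
            Smooth.pull (skipTuple b a (by omega) 0)
              (Smooth.dV 0 i (φ : Smooth d (a + 1)))) := by
    intro α i
    rw [map_sub, map_sub]
    congr 1
    · exact (congrArg _ (hα α _ _)).trans (Dist.ofState_pull_perm _ _ _)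
    · rw [mul_comm]
      refine ((congrArg _ (hα α _ _)).trans (Dist.ofState_pull_perm _ _ _)).trans ?_
      refine Eq.symm ((Dist.ofState_pull_perm γ (blockSwap a b) _).symm.trans ?_)
      rw [Smooth.pull_mul, Smooth.pull_pull, Smooth.pull_pull,
        blockSwap_comp_firstTuple a b _ h', blockSwap_comp_skipTuple a b h, mul_comm]
      rfl
  rw [LinearMap.smul_apply, h1, poissonBracket_firstTuple_skipTuple, ← Dist.ofState_apply,
    wedgeOne, map_smul, map_sum, map_sum]
  simp only [map_sum, hterm]
  rw [Finset.sum_const, Finset.card_univ, Fintype.card_fin, ← Nat.cast_smul_eq_nsmul ℝ, smul_smul,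
    Nat.cast_mul, mul_comm ((b + 1 : ℕ) : ℝ)]

theorem continuous_wedgeOne_left {a b : ℕ} (g : Smooth d (b + 1)) :
    Continuous fun f : Smooth d (a + 1) => wedgeOne f g := by
  unfold wedgeOne
  refine Continuous.const_smul (M := ℝ) ?_ _
  refine continuous_finsetSum _ fun i _ => ?_
  refine Continuous.sub ?_ ?_
  · exact (Smooth.continuous_mul_const _).comp
      ((Smooth.continuous_pull _).comp (Smooth.continuous_dirDeriv _))
  · exact (Smooth.continuous_const_mul _).comp
      ((Smooth.continuous_pull _).comp (Smooth.continuous_dirDeriv _))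

/-- The map `f ↦ Sym (f ∧₁ g)` of homogeneous observables, as a continuous linear map. -/
def bracketCLM (a : ℕ) {b : ℕ} (g : Obs d (b + 1)) : Obs d (a + 1) →L[ℝ] Obs d (a + b + 1) where
  toFun f := symmetrize d (a + b + 1) (wedgeOne (f : Smooth d (a + 1)) (g : Smooth d (b + 1)))
  map_add' f f' := by
    rw [← map_add]
    congr 1
    simp only [wedgeOne, ← smul_add, ← Finset.sum_add_distrib, Submodule.coe_add, map_add,
      add_mul, mul_add, sub_add_sub_comm]
  map_smul' c f := by
    rw [← map_smul]
    congr 1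
    simp only [wedgeOne, Submodule.coe_smul, map_smul, RingHom.id_apply, smul_mul_assoc,
      mul_smul_comm, ← smul_sub, ← Finset.smul_sum]
    rw [smul_comm]
  cont := (continuous_symmetrize d _).comp
    ((continuous_wedgeOne_left _).comp continuous_subtype_val)

/-- Instance search does not derive this from `IsTopologicalAddGroup`. -/
instance (k : ℕ) : ContinuousAdd (StrongDual ℝ (Obs d k)) :=
  (inferInstance : IsTopologicalAddGroup (StrongDual ℝ (Obs d k))).toContinuousAdd

open scoped Classical in
/-- The transpose `𝔊_∞^* → 𝔊_∞^*` of `F ↦ [F, G]`. -/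
def coad (G : GInf d) : GInfStar d →L[ℝ] GInfStar d :=
  ContinuousLinearMap.pi fun a => ∑ b ∈ DFinsupp.support G,
    (ContinuousLinearMap.precomp ℝ (bracketCLM a (G b))).comp
      (ContinuousLinearMap.proj (a + b))

open scoped Classical in
theorem coad_apply (G : GInf d) (Γ : GInfStar d) (a : ℕ) (φ : Obs d (a + 1)) :
    coad G Γ a φ = ∑ b ∈ DFinsupp.support G, Γ (a + b) (bracketCLM a (G b) φ) := by
  simp [coad]

open scoped Classical in
theorem pairing_eq_sum (F : GInf d) (Γ : GInfStar d) :
    pairing F Γ = ∑ a ∈ DFinsupp.support F, Γ a (F a) := by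
  conv_lhs => rw [← DirectSum.sum_support_of F]
  rw [pairing_sum]
  exact Finset.sum_congr rfl fun n _ => pairing_of n (F n) Γ

theorem pairing_lieBracket (F G : GInf d) (Γ : GInfStar d) :
    pairing (lieBracket F G) Γ = pairing F (coad G Γ) := by
  rw [pairing_eq_sum F, lieBracket, pairing_sum]
  refine Finset.sum_congr rfl fun a _ => ?_
  rw [pairing_sum, coad_apply]
  exact Finset.sum_congr rfl fun b _ => pairing_of _ _ Γ

theorem coad_derivObs_eq_hamField (𝓖 : GInfStar d → ℝ) (Γ : GInfStar d) (a : ℕ)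
    (φ : Obs d (a + 1)) :
    coad (derivObs 𝓖 Γ) Γ a φ = hamField 𝓖 Γ a (φ : Smooth d (a + 1)) := by
  classical
  rw [coad_apply, hamField, finsum_eq_sum_of_support_subset
    (s := DFinsupp.support (derivObs 𝓖 Γ)), LinearMap.sum_apply]
  · exact Finset.sum_congr (by congr) fun b _ =>
      (smul_marginal_poisson_apply φ (derivObs 𝓖 Γ b) (Γ (a + b)) _ _).symm
  · intro b hb
    by_contra h
    refine hb ?_
    have h0 : derivObs 𝓖 Γ b = 0 := DFinsupp.notMem_support_iff.1 h
    refine LinearMap.ext fun ψ => ?_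
    have h1 : ∀ T : Dist d (a + b + 1), Dist.poisson 0 T = 0 := fun T =>
      LinearMap.ext fun ψ => by
        rw [Dist.poisson_apply, map_zero, map_zero]
        rfl
    simp only [h0, ZeroMemClass.coe_zero, map_zero, Finset.sum_const_zero, h1]
    rw [LinearMap.smul_apply]
    exact smul_zero _

end HamField

/-! ### The Lie-Poisson bracket -/

section LiePoisson

variable {d : ℕ}

theorem eq_of_forall_pairing_eq {Γ Δ : GInfStar d} (h : ∀ F, pairing F Γ = pairing F Δ) :
    Γ = Δ := by
  funext a
  refine ContinuousLinearMap.ext fun f => ?_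
  simpa only [pairing_of] using h (DirectSum.of (fun n : ℕ => Obs d (n + 1)) a f)

theorem coad_zero (Γ : GInfStar d) : coad 0 Γ = 0 :=
  eq_of_forall_pairing_eq fun F => by
    rw [← pairing_lieBracket, lieBracket_zero_right, pairing_zero]
    exact (map_zero (pairingCLM F)).symm

theorem coad_add (F G : GInf d) (Γ : GInfStar d) : coad (F + G) Γ = coad F Γ + coad G Γ :=
  eq_of_forall_pairing_eq fun H => by
    refine Eq.trans ?_ (map_add (pairingCLM H) (coad F Γ) (coad G Γ)).symm
    simp only [pairingCLM_apply, ← pairing_lieBracket, lieBracket_add_right, pairing_add]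

theorem coad_smul (c : ℝ) (F : GInf d) (Γ : GInfStar d) : coad (c • F) Γ = c • coad F Γ :=
  eq_of_forall_pairing_eq fun H => by
    refine Eq.trans ?_ (map_smul (pairingCLM H) c (coad F Γ)).symm
    simp only [pairingCLM_apply, ← pairing_lieBracket, lieBracket_smul_right, pairing_smul,
      smul_eq_mul]

variable {𝓕 𝓖 𝓗 𝓚 : GInfStar d → ℝ}

theorem lpBracket_pairing (F G : GInf d) : lpBracket d (fun Γ => pairing F Γ)
    (fun Γ => pairing G Γ) = fun Γ => pairing (lieBracket F G) Γ := by
  funext Γ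
  rw [lpBracket, derivObs_pairing, derivObs_pairing]

theorem lpBracket_skew (𝓕 𝓖 : GInfStar d → ℝ) : lpBracket d 𝓕 𝓖 = -lpBracket d 𝓖 𝓕 := by
  funext Γ
  rw [lpBracket, lieBracket_skew]
  exact map_neg (DirectSum.toModule ℝ ℕ ℝ fun n => (Γ n : Obs d (n + 1) →ₗ[ℝ] ℝ)) _

theorem lpBracket_const_right (𝓕 : GInfStar d → ℝ) (c : ℝ) :
    lpBracket d 𝓕 (fun _ => c) = 0 := by
  funext Γ
  rw [lpBracket, derivObs_const, lieBracket_zero_right, pairing_zero]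
  rfl

theorem lpBracket_add_right (𝓕 : GInfStar d → ℝ) (h𝓖 : IsGateauxSmooth 𝓖)
    (h𝓗 : IsGateauxSmooth 𝓗) :
    lpBracket d 𝓕 (𝓖 + 𝓗) = lpBracket d 𝓕 𝓖 + lpBracket d 𝓕 𝓗 := by
  funext Γ
  rw [lpBracket, derivObs_add h𝓖 h𝓗, lieBracket_add_right, pairing_add]
  rfl

theorem lpBracket_smul_right (c : ℝ) (𝓕 : GInfStar d → ℝ) (h𝓖 : IsGateauxSmooth 𝓖) :
    lpBracket d 𝓕 (c • 𝓖) = c • lpBracket d 𝓕 𝓖 := by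
  funext Γ
  rw [lpBracket, derivObs_smul c h𝓖, lieBracket_smul_right, pairing_smul]
  rfl

theorem lpBracket_mul_right (𝓕 : GInfStar d → ℝ) (h𝓖 : IsGateauxSmooth 𝓖)
    (h𝓗 : IsGateauxSmooth 𝓗) :
    lpBracket d 𝓕 (𝓖 * 𝓗) = 𝓗 * lpBracket d 𝓕 𝓖 + 𝓖 * lpBracket d 𝓕 𝓗 := by
  funext Γ
  rw [lpBracket, derivObs_mul h𝓖 h𝓗, lieBracket_add_right, lieBracket_smul_right,
    lieBracket_smul_right, pairing_add, pairing_smul, pairing_smul]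
  rfl

theorem lpBracket_add_left (𝓗 : GInfStar d → ℝ) (h𝓕 : IsGateauxSmooth 𝓕)
    (h𝓖 : IsGateauxSmooth 𝓖) :
    lpBracket d (𝓕 + 𝓖) 𝓗 = lpBracket d 𝓕 𝓗 + lpBracket d 𝓖 𝓗 := by
  rw [lpBracket_skew, lpBracket_add_right 𝓗 h𝓕 h𝓖, lpBracket_skew 𝓗, lpBracket_skew 𝓗]
  ring

theorem lpBracket_smul_left (c : ℝ) (𝓖 : GInfStar d → ℝ) (h𝓕 : IsGateauxSmooth 𝓕) :
    lpBracket d (c • 𝓕) 𝓖 = c • lpBracket d 𝓕 𝓖 := by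
  rw [lpBracket_skew, lpBracket_smul_right c 𝓖 h𝓕, lpBracket_skew 𝓖, smul_neg, neg_neg]

theorem lpBracket_mul_left (𝓗 : GInfStar d → ℝ) (h𝓕 : IsGateauxSmooth 𝓕)
    (h𝓖 : IsGateauxSmooth 𝓖) :
    lpBracket d (𝓕 * 𝓖) 𝓗 = 𝓖 * lpBracket d 𝓕 𝓗 + 𝓕 * lpBracket d 𝓖 𝓗 := by
  rw [lpBracket_skew, lpBracket_mul_right 𝓗 h𝓕 h𝓖, lpBracket_skew 𝓗, lpBracket_skew 𝓗]
  ring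

theorem lpBracket_eq_gateauxDeriv (h𝓕 : IsGateauxSmooth 𝓕) (𝓖 : GInfStar d → ℝ)
    (Γ : GInfStar d) :
    lpBracket d 𝓕 𝓖 Γ = gateauxDeriv 𝓕 Γ (coad (derivObs 𝓖 Γ) Γ) := by
  rw [h𝓕.gateauxDeriv_eq, lpBracket, pairing_lieBracket]

/-! ### The algebra generated by the expectation functionals -/

theorem pairing_mem_aInf (F : GInf d) : (fun Γ => pairing F Γ) ∈ AInf d :=
  Algebra.subset_adjoin (Or.inl ⟨isGateauxSmooth_pairing F, F, rfl⟩)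

theorem aInf_induction {p : (GInfStar d → ℝ) → Prop}
    (pairing : ∀ F : GInf d, p fun Γ => pairing F Γ) (const : ∀ c : ℝ, p fun _ => c)
    (add : ∀ 𝓕 ∈ AInf d, ∀ 𝓖 ∈ AInf d, p 𝓕 → p 𝓖 → p (𝓕 + 𝓖))
    (mul : ∀ 𝓕 ∈ AInf d, ∀ 𝓖 ∈ AInf d, p 𝓕 → p 𝓖 → p (𝓕 * 𝓖))
    (h𝓕 : 𝓕 ∈ AInf d) : p 𝓕 := by
  refine Algebra.adjoin_induction (p := fun 𝓕 _ => p 𝓕) ?_ (fun c => const c)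
    (fun 𝓕 𝓖 h𝓕 h𝓖 => add 𝓕 h𝓕 𝓖 h𝓖) (fun 𝓕 𝓖 h𝓕 h𝓖 => mul 𝓕 h𝓕 𝓖 h𝓖) h𝓕
  rintro _ (⟨-, F, rfl⟩ | ⟨-, c, rfl⟩)
  · exact pairing F
  · exact const c

theorem isGateauxSmooth_of_mem_aInf (h𝓕 : 𝓕 ∈ AInf d) : IsGateauxSmooth 𝓕 :=
  aInf_induction isGateauxSmooth_pairing IsGateauxSmooth.const
    (fun _ _ _ _ h𝓕 h𝓖 => h𝓕.add h𝓖) (fun _ _ _ _ h𝓕 h𝓖 => h𝓕.smul h𝓖) h𝓕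

theorem lpBracket_mem_aInf_of_pairing (h𝓕 : ∀ G : GInf d,
    lpBracket d 𝓕 (fun Γ => pairing G Γ) ∈ AInf d) (h𝓖 : 𝓖 ∈ AInf d) :
    lpBracket d 𝓕 𝓖 ∈ AInf d := by
  refine aInf_induction (p := fun 𝓖 => lpBracket d 𝓕 𝓖 ∈ AInf d) h𝓕 (fun c => ?_) ?_ ?_ h𝓖
  · rw [lpBracket_const_right]
    exact zero_mem _
  · intro 𝓖 h𝓖 𝓗 h𝓗 h1 h2
    rw [lpBracket_add_right 𝓕 (isGateauxSmooth_of_mem_aInf h𝓖) (isGateauxSmooth_of_mem_aInf h𝓗)]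
    exact add_mem h1 h2
  · intro 𝓖 h𝓖 𝓗 h𝓗 h1 h2
    rw [lpBracket_mul_right 𝓕 (isGateauxSmooth_of_mem_aInf h𝓖) (isGateauxSmooth_of_mem_aInf h𝓗)]
    exact add_mem (mul_mem h𝓗 h1) (mul_mem h𝓖 h2)

theorem lpBracket_mem_aInf (h𝓕 : 𝓕 ∈ AInf d) (h𝓖 : 𝓖 ∈ AInf d) : lpBracket d 𝓕 𝓖 ∈ AInf d := by
  refine lpBracket_mem_aInf_of_pairing (fun G => ?_) h𝓖
  rw [lpBracket_skew]
  refine neg_mem (lpBracket_mem_aInf_of_pairing (fun F => ?_) h𝓕)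
  rw [lpBracket_pairing]
  exact pairing_mem_aInf _

/-- The Jacobiator of the Lie-Poisson bracket. -/
def jacobiator (𝓕 𝓖 𝓗 : GInfStar d → ℝ) : GInfStar d → ℝ :=
  lpBracket d 𝓕 (lpBracket d 𝓖 𝓗) + lpBracket d 𝓖 (lpBracket d 𝓗 𝓕) +
    lpBracket d 𝓗 (lpBracket d 𝓕 𝓖)

theorem jacobiator_rotate (𝓕 𝓖 𝓗 : GInfStar d → ℝ) :
    jacobiator 𝓕 𝓖 𝓗 = jacobiator 𝓖 𝓗 𝓕 := by
  simp only [jacobiator]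
  ring

/-- The Jacobiator is a derivation in its last argument, so that it suffices to test it on the
expectation functionals. -/
theorem jacobiator_eq_zero_of_pairing (h𝓕 : 𝓕 ∈ AInf d) (h𝓖 : 𝓖 ∈ AInf d)
    (h : ∀ H : GInf d, jacobiator 𝓕 𝓖 (fun Γ => pairing H Γ) = 0) (h𝓗 : 𝓗 ∈ AInf d) :
    jacobiator 𝓕 𝓖 𝓗 = 0 := by
  have hs : ∀ {𝓚 : GInfStar d → ℝ}, 𝓚 ∈ AInf d → IsGateauxSmooth 𝓚 := fun h =>
    isGateauxSmooth_of_mem_aInf h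
  refine aInf_induction (p := fun 𝓗 => jacobiator 𝓕 𝓖 𝓗 = 0) h (fun c => ?_) ?_ ?_ h𝓗
  · have h0 : lpBracket d (fun _ : GInfStar d => c) 𝓕 = 0 := by
      rw [lpBracket_skew, lpBracket_const_right, neg_zero]
    have h1 : ∀ 𝓚 : GInfStar d → ℝ, lpBracket d 𝓚 0 = 0 := fun 𝓚 => lpBracket_const_right 𝓚 0
    rw [jacobiator, lpBracket_const_right, h0, h1, h1, lpBracket_skew, lpBracket_const_right]
    simp
  · intro 𝓗 h𝓗 𝓚 h𝓚 h1 h2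
    rw [jacobiator] at h1 h2 ⊢
    rw [lpBracket_add_right 𝓖 (hs h𝓗) (hs h𝓚), lpBracket_add_left 𝓕 (hs h𝓗) (hs h𝓚),
      lpBracket_add_left _ (hs h𝓗) (hs h𝓚),
      lpBracket_add_right 𝓕 (hs (lpBracket_mem_aInf h𝓖 h𝓗)) (hs (lpBracket_mem_aInf h𝓖 h𝓚)),
      lpBracket_add_right 𝓖 (hs (lpBracket_mem_aInf h𝓗 h𝓕)) (hs (lpBracket_mem_aInf h𝓚 h𝓕))]
    linear_combination h1 + h2
  · intro 𝓗 h𝓗 𝓚 h𝓚 h1 h2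
    have m1 := lpBracket_mem_aInf h𝓖 h𝓗
    have m2 := lpBracket_mem_aInf h𝓖 h𝓚
    have m3 := lpBracket_mem_aInf h𝓗 h𝓕
    have m4 := lpBracket_mem_aInf h𝓚 h𝓕
    rw [jacobiator] at h1 h2 ⊢
    rw [lpBracket_mul_right 𝓖 (hs h𝓗) (hs h𝓚), lpBracket_mul_left 𝓕 (hs h𝓗) (hs h𝓚),
      lpBracket_mul_left _ (hs h𝓗) (hs h𝓚),
      lpBracket_add_right 𝓕 (hs (mul_mem h𝓚 m1)) (hs (mul_mem h𝓗 m2)),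
      lpBracket_add_right 𝓖 (hs (mul_mem h𝓚 m3)) (hs (mul_mem h𝓗 m4)),
      lpBracket_mul_right 𝓕 (hs h𝓚) (hs m1), lpBracket_mul_right 𝓕 (hs h𝓗) (hs m2),
      lpBracket_mul_right 𝓖 (hs h𝓚) (hs m3), lpBracket_mul_right 𝓖 (hs h𝓗) (hs m4),
      lpBracket_skew 𝓚 𝓕, lpBracket_skew 𝓗 𝓕]
    rw [lpBracket_skew 𝓗 𝓕] at h1
    rw [lpBracket_skew 𝓚 𝓕] at h2
    linear_combination 𝓚 * h1 + 𝓗 * h2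

theorem jacobiator_eq_zero (h𝓕 : 𝓕 ∈ AInf d) (h𝓖 : 𝓖 ∈ AInf d) (h𝓗 : 𝓗 ∈ AInf d) :
    jacobiator 𝓕 𝓖 𝓗 = 0 := by
  refine jacobiator_eq_zero_of_pairing h𝓕 h𝓖 (fun H => ?_) h𝓗
  rw [← jacobiator_rotate]
  refine jacobiator_eq_zero_of_pairing (pairing_mem_aInf H) h𝓕 (fun G => ?_) h𝓖
  rw [← jacobiator_rotate]
  refine jacobiator_eq_zero_of_pairing (pairing_mem_aInf G) (pairing_mem_aInf H) (fun F => ?_) h𝓕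
  simp only [jacobiator, lpBracket_pairing]
  funext Γ
  change pairing _ Γ + pairing _ Γ + pairing _ Γ = 0
  rw [← pairing_add, ← pairing_add, lieBracket_jacobi, pairing_zero]

/-- The product rule writes the Hamiltonian vector field of a product as a combination of the
vector fields of the factors, and for the expectation functionals the field is continuous and
linear. -/
theorem isGateauxSmooth_hamiltonian (h𝓖 : 𝓖 ∈ AInf d) :
    IsGateauxSmooth fun Γ : GInfStar d => coad (derivObs 𝓖 Γ) Γ := by
  refine aInf_induction (p := fun 𝓖 => IsGateauxSmooth fun Γ : GInfStar d =>
    coad (derivObs 𝓖 Γ) Γ) (fun G => ?_) (fun c => ?_) ?_ ?_ h𝓖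
  · simp only [derivObs_pairing]
    exact IsGateauxSmooth.map_linear (X := GInfStar d) (Y := GInfStar d) (coad G)
  · simp only [derivObs_const, coad_zero]
    exact IsGateauxSmooth.const 0
  · intro 𝓕 h𝓕 𝓖 h𝓖 h1 h2
    simp only [derivObs_add (isGateauxSmooth_of_mem_aInf h𝓕) (isGateauxSmooth_of_mem_aInf h𝓖),
      coad_add]
    exact h1.add h2
  · intro 𝓕 h𝓕 𝓖 h𝓖 h1 h2
    have s1 := isGateauxSmooth_of_mem_aInf h𝓕
    have s2 := isGateauxSmooth_of_mem_aInf h𝓖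
    simp only [derivObs_mul s1 s2, coad_add, coad_smul]
    exact (s2.smul h1).add (s1.smul h2)

theorem isWeakPoissonVectorSpace (d : ℕ) : IsWeakPoissonVectorSpace (AInf d) (lpBracket d) where
  smooth _ h𝓕 := isGateauxSmooth_of_mem_aInf h𝓕
  bracket_mem _ h𝓕 _ h𝓖 := lpBracket_mem_aInf h𝓕 h𝓖
  add_left _ h𝓕 _ h𝓖 𝓗 _ := lpBracket_add_left 𝓗 (isGateauxSmooth_of_mem_aInf h𝓕)
    (isGateauxSmooth_of_mem_aInf h𝓖)
  smul_left c _ h𝓕 𝓖 _ := lpBracket_smul_left c 𝓖 (isGateauxSmooth_of_mem_aInf h𝓕)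
  add_right 𝓕 _ _ h𝓖 _ h𝓗 := lpBracket_add_right 𝓕 (isGateauxSmooth_of_mem_aInf h𝓖)
    (isGateauxSmooth_of_mem_aInf h𝓗)
  smul_right c 𝓕 _ _ h𝓖 := lpBracket_smul_right c 𝓕 (isGateauxSmooth_of_mem_aInf h𝓖)
  antisymm 𝓕 _ 𝓖 _ := lpBracket_skew 𝓕 𝓖
  jacobi _ h𝓕 _ h𝓖 _ h𝓗 := jacobiator_eq_zero h𝓕 h𝓖 h𝓗
  leibniz 𝓕 _ _ h𝓖 _ h𝓗 := lpBracket_mul_right 𝓕 (isGateauxSmooth_of_mem_aInf h𝓖)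
    (isGateauxSmooth_of_mem_aInf h𝓗)
  nondegenerate Γ Δ h := by
    refine eq_of_forall_pairing_eq fun F => ?_
    have h1 := h _ (pairing_mem_aInf F)
    rw [(isGateauxSmooth_pairing F).gateauxDeriv_eq, derivObs_pairing] at h1
    rw [h1]
    exact (map_zero (pairingCLM F)).symm
  hamiltonian 𝓕 h𝓕 := ⟨fun Γ => coad (derivObs 𝓕 Γ) Γ, isGateauxSmooth_hamiltonian h𝓕,
    fun _ h𝓖 Γ => (lpBracket_eq_gateauxDeriv (isGateauxSmooth_of_mem_aInf h𝓖) 𝓕 Γ).symm⟩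

end LiePoisson

end VlasovHierarchy

end

theorem mainTheorem2 (d : ℕ) :
    -- the derivative of a smooth functional is identified with a unique element of `𝔊_∞`
    (∀ 𝓕 : VlasovHierarchy.GInfStar d → ℝ, VlasovHierarchy.IsGateauxSmooth 𝓕 →
      ∀ Γ : VlasovHierarchy.GInfStar d,
        ∃! F : VlasovHierarchy.GInf d, VlasovHierarchy.RepresentsDeriv 𝓕 Γ F) ∧
    -- the weak Poisson structure
    VlasovHierarchy.IsWeakPoissonVectorSpace
      (VlasovHierarchy.AInf d) (VlasovHierarchy.lpBracket d) ∧
    -- the Hamiltonian vector fields and their explicit form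
    (∀ 𝓖 : VlasovHierarchy.GInfStar d → ℝ, VlasovHierarchy.IsGateauxSmooth 𝓖 →
      ∃ V : VlasovHierarchy.GInfStar d → VlasovHierarchy.GInfStar d,
        (∀ 𝓕 : VlasovHierarchy.GInfStar d → ℝ, VlasovHierarchy.IsGateauxSmooth 𝓕 →
          ∀ Γ, VlasovHierarchy.lpBracket d 𝓕 𝓖 Γ = VlasovHierarchy.gateauxDeriv 𝓕 Γ (V Γ)) ∧
        (∀ W : VlasovHierarchy.GInfStar d → VlasovHierarchy.GInfStar d,
          (∀ 𝓕 : VlasovHierarchy.GInfStar d → ℝ, VlasovHierarchy.IsGateauxSmooth 𝓕 →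
            ∀ Γ, VlasovHierarchy.lpBracket d 𝓕 𝓖 Γ = VlasovHierarchy.gateauxDeriv 𝓕 Γ (W Γ)) →
          W = V) ∧
        (∀ (Γ : VlasovHierarchy.GInfStar d) (a : ℕ) (φ : VlasovHierarchy.Obs d (a + 1)),
          V Γ a φ = VlasovHierarchy.hamField 𝓖 Γ a (φ : VlasovHierarchy.Smooth d (a + 1))) ∧
        (𝓖 ∈ VlasovHierarchy.AInf d → VlasovHierarchy.IsGateauxSmooth V)) := by
  refine ⟨fun 𝓕 h𝓕 Γ => h𝓕.existsUnique_representsDeriv Γ,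
    VlasovHierarchy.isWeakPoissonVectorSpace d, fun 𝓖 _ =>
    ⟨fun Γ => VlasovHierarchy.coad (VlasovHierarchy.derivObs 𝓖 Γ) Γ,
      fun 𝓕 h𝓕 Γ => VlasovHierarchy.lpBracket_eq_gateauxDeriv h𝓕 𝓖 Γ, fun W hW => ?_,
      VlasovHierarchy.coad_derivObs_eq_hamField 𝓖,
      VlasovHierarchy.isGateauxSmooth_hamiltonian⟩⟩
  funext Γ
  refine VlasovHierarchy.eq_of_forall_pairing_eq fun F => ?_
  -- testing against the expectation functional of `F` determines the pairing with `F`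
  have hF := VlasovHierarchy.isGateauxSmooth_pairing F
  have h := (hW _ hF Γ).symm.trans (VlasovHierarchy.lpBracket_eq_gateauxDeriv hF 𝓖 Γ)
  rwa [hF.gateauxDeriv_eq, hF.gateauxDeriv_eq, VlasovHierarchy.derivObs_pairing] at h
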